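/- **Proposition (correctness of the flow algorithm for the proximal operator).** Let $p\ge 0$, let $\mathcal G$ be a finite family of (arbitrary, possibly overlapping) subsets of $\{1,\dots,p\}$, let $\eta_g>0$ for $g\in\mathcal G$, let $\lambda\ge 0$, and put $\Omega(w)=\sum_{g\in\mathcal G}\eta_g\|w_g\|_\infty$, where $w_g=(w_j)_{j\in g}$. For $u\in\mathbb R^p$ let $\mathrm{Prox}_{\lambda\Omega}(u)$ be the unique minimizer over $w\in\mathbb R^p$ of $\frac12\|u-w\|_2^2+\lambda\Omega(w)$. *Graphs.* The canonical graph has a source $s$, a sink $t$ and the vertex set $V_0=\{1,\dots,p\}\cup\mathcal G$; its arcs are $(s,g)$ with capacity $\lambda\eta_g$ for $g\in\mathcal G$, $(g,j)$ with infinite capacity for $g\in\mathcal G$ and $j\in g$, and $(j,t)$ with infinite capacity for $1\le j\le p$. A capacitated directed graph on the same nodes, in which no arc enters $s$ or leaves $t$, is *equivalent* to it if it has the same arcs out of $s$ and into $t$, with the same capacities; if for all $g\in\mathcal G$ and $j\in g$ there is a unique directed path from $g$ to $j$ all of whose arcs have infinite capacity; and if $j\in g$ whenever there is a directed path from a vertex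 $g\in\mathcal G$ to a vertex $j\in\{1,\dots,p\}$. *Procedure.* Fix an initial graph $G_0$ and a vector $u\in\mathbb R_{\ge 0}^p$. For $V\subseteq V_0$ write $V_u=V\cap\{1,\dots,p\}$ and $V_{gr}=V\cap\mathcal G$. The procedure $\mathtt{computeFlow}(V)$ works on the subgraph of $G_0$ induced by $V\cup\{s,t\}$ as follows. 1. Let $(\gamma_j)_{j\in V_u}$ be the Euclidean projection of $(u_j)_{j\in V_u}$ onto the $\ell_1$-ball of radius $\lambda\sum_{g\in V_{gr}}\eta_g$. 2. Give each arc $(j,t)$, $j\in V_u$, the capacity $\gamma_j$, compute a maximum flow from $s$ to $t$, and let $\bar\xi_j$ be its value on $(j,t)$. 3. If $\bar\xi_j=\gamma_j$ for all $j\in V_u$, return $(\bar\xi_j)_{j\in V_u}$. Otherwise take a minimum $(s,t)$-cut of this graph, let $V^+$ and $V^-$ be the sets of vertices of $V$ on its source side and on its sink side, and return the values given by $\mathtt{computeFlow}(V^+)$ on $V^+_u$ and by $\mathtt{computeFlow}(V^-)$ on $V^-_u$. For an input $u\in\mathbb R^p$ the algorithm runs $\mathtt{computeFlow}(V_0)$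 with the vector $(|u_j|)_j$, which gives $\bar\xi$, and returns the vector $w$ with $w_j=u_j-\bar\xi_j$ if $u_j\ge 0$ and $w_j=u_j+\bar\xi_j$ if $u_j<0$; in particular $w=u-\bar\xi$ if $u\ge 0$. *Claim.* Let $G_0$ be the canonical graph or any graph equivalent to it. Then, for every $u\in\mathbb R^p$ and whatever maximum flows and minimum cuts are chosen, the recursion terminates; the algorithm returns a vector; and every vector it returns is $\mathrm{Prox}_{\lambda\Omega}(u)$. -/

import Mathlib

open scoped ENNReal

/-! ### Capacitated graphs, flows and cuts

A capacitated directed graph on a finite node type `N` with source `s` and sink `t` is given by its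
capacity function `c : N → N → ℝ≥0∞`; the arcs are the pairs of positive capacity. -/

section Networks

variable {N : Type*} [Fintype N]

/-- A flow: non-negative on arcs, within the capacities, conserved except at `s` and `t`. -/
structure IsFlow (c : N → N → ℝ≥0∞) (s t : N) (f : N → N → ℝ) : Prop where
  nonneg : ∀ a b, 0 ≤ f a b
  le_cap : ∀ a b, ENNReal.ofReal (f a b) ≤ c a b
  conserved : ∀ v, v ≠ s → v ≠ t → ∑ a, f a v = ∑ b, f v b

/-- The value of a flow: the net amount leaving the source. -/
def flowValue (s : N) (f : N → N → ℝ) : ℝ :=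
  ∑ b, f s b - ∑ a, f a s

def IsMaxFlow (c : N → N → ℝ≥0∞) (s t : N) (f : N → N → ℝ) : Prop :=
  IsFlow c s t f ∧ ∀ f', IsFlow c s t f' → flowValue s f' ≤ flowValue s f

variable [DecidableEq N]

/-- The capacity of the cut `(S, Sᶜ)`. -/
noncomputable def cutCapacity (c : N → N → ℝ≥0∞) (S : Finset N) : ℝ≥0∞ :=
  ∑ a ∈ S, ∑ b ∈ Sᶜ, c a b

/-- `S` is the source side of a minimum `(s,t)`-cut. -/
def IsMinCut (c : N → N → ℝ≥0∞) (s t : N) (S : Finset N) : Prop :=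
  s ∈ S ∧ t ∉ S ∧ ∀ S' : Finset N, s ∈ S' → t ∉ S' → cutCapacity c S ≤ cutCapacity c S'

/-- `l` is the vertex list of a directed path (without repeated vertices) from `a` to `b`. -/
def IsDirPath (c : N → N → ℝ≥0∞) (a b : N) (l : List N) : Prop :=
  l.Nodup ∧ l.head? = some a ∧ l.getLast? = some b ∧ l.IsChain (fun x y => 0 < c x y)

end Networks

/-! ### The graphs of a group structure

Variables are the indices `j : Fin p`; the groups form a finite family `grp : κ → Finset (Fin p)`
with weights `η : κ → ℝ`. The vertex set is `V = V_u ∪ V_gr = Fin p ⊕ κ`, and the nodes are the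
vertices together with the source `Sum.inl false` and the sink `Sum.inl true`. -/

abbrev Vertex (p : ℕ) (κ : Type*) := Fin p ⊕ κ

abbrev Node (p : ℕ) (κ : Type*) := Bool ⊕ Vertex p κ

section Graphs

variable {p : ℕ} {κ : Type*}

abbrev source : Node p κ := Sum.inl false

abbrev sink : Node p κ := Sum.inl true

abbrev varNode (j : Fin p) : Node p κ := Sum.inr (Sum.inl j)

abbrev grpNode (g : κ) : Node p κ := Sum.inr (Sum.inr g)

/-- The canonical graph: an arc `(s,g)` of capacity `λ η_g` for each group, an arc `(g,j)` of
infinite capacity for each `j ∈ g`, an arc `(j,t)` of infinite capacity for each variable. -/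
noncomputable def canonicalGraph (grp : κ → Finset (Fin p)) (η : κ → ℝ) (lam : ℝ) :
    Node p κ → Node p κ → ℝ≥0∞
  | Sum.inl false, Sum.inr (Sum.inr g) => ENNReal.ofReal (lam * η g)
  | Sum.inr (Sum.inr g), Sum.inr (Sum.inl j) => if j ∈ grp g then ⊤ else 0
  | Sum.inr (Sum.inl _), Sum.inl true => ⊤
  | _, _ => 0

/-- A graph on the same nodes that is equivalent to the canonical one: same arcs out of the source
and into the sink, and a unique path of infinite capacity from `g` to `j` for each `j ∈ g`, while
any path from a group `g` to a variable `j` forces `j ∈ g`. As usual in a network, no arc enters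
the source or leaves the sink. Arc costs play no role in the algorithm and are not recorded. -/
structure IsEquivalentGraph (grp : κ → Finset (Fin p)) (η : κ → ℝ) (lam : ℝ)
    (c : Node p κ → Node p κ → ℝ≥0∞) : Prop where
  into_source : ∀ v, c v source = 0
  out_of_sink : ∀ v, c sink v = 0
  out_of_source : ∀ v, c source v = canonicalGraph grp η lam source v
  into_sink : ∀ v, c v sink = canonicalGraph grp η lam v sink
  path_of_mem : ∀ g j, j ∈ grp g →
    ∃! l, IsDirPath c (grpNode g) (varNode j) l ∧ l.IsChain (fun x y => c x y = ⊤)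
  mem_of_path : ∀ g j l, IsDirPath c (grpNode g) (varNode j) l → j ∈ grp g

/-! ### The procedure `computeFlow` -/

variable [DecidableEq κ]

/-- The node is `s`, `t`, or a vertex of `V`. -/
def InCall (V : Finset (Vertex p κ)) : Node p κ → Prop
  | Sum.inl _ => True
  | Sum.inr v => v ∈ V

/-- `γ_j` is made the capacity of each arc `(j,t)`. -/
noncomputable def setSinkCapacity (c : Node p κ → Node p κ → ℝ≥0∞) (γ : Fin p → ℝ) :
    Node p κ → Node p κ → ℝ≥0∞
  | Sum.inr (Sum.inl j), Sum.inl true => ENNReal.ofReal (γ j)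
  | a, b => c a b

open Classical in
/-- The graph `(V, E, s, t)` of the max-flow step in a call on the vertex set `V`: the arcs of the
initial graph `c` between nodes of `V ∪ {s, t}`, with capacities `γ_j` on the arcs `(j,t)`. -/
noncomputable def callGraph (c : Node p κ → Node p κ → ℝ≥0∞) (V : Finset (Vertex p κ))
    (γ : Fin p → ℝ) (a b : Node p κ) : ℝ≥0∞ :=
  if InCall V a ∧ InCall V b then setSinkCapacity c γ a b else 0

def varsOf (V : Finset (Vertex p κ)) : Finset (Fin p) :=
  Finset.univ.filter fun j => Sum.inl j ∈ V

/-- The vertices of `V` on the source side (`V⁺`) and on the sink side (`V⁻`) of a cut. -/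
def plusPart (V : Finset (Vertex p κ)) (S : Finset (Node p κ)) : Finset (Vertex p κ) :=
  V.filter fun v => Sum.inr v ∈ S

def minusPart (V : Finset (Vertex p κ)) (S : Finset (Node p κ)) : Finset (Vertex p κ) :=
  V.filter fun v => Sum.inr v ∉ S

variable [Fintype κ]

def grpsOf (V : Finset (Vertex p κ)) : Finset κ :=
  Finset.univ.filter fun g => Sum.inr g ∈ V

/-- Projection step: `(γ_j)_{j ∈ V_u}` is the Euclidean projection of `(u_j)_{j ∈ V_u}` onto the
`ℓ¹`-ball of radius `λ ∑_{g ∈ V_gr} η_g`. (Values of `γ` outside `V_u` are never used.) -/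
def IsProjectionStep (η : κ → ℝ) (lam : ℝ) (u : Fin p → ℝ) (V : Finset (Vertex p κ))
    (γ : Fin p → ℝ) : Prop :=
  ∑ j ∈ varsOf V, |γ j| ≤ lam * ∑ g ∈ grpsOf V, η g ∧
  ∀ γ' : Fin p → ℝ, ∑ j ∈ varsOf V, |γ' j| ≤ lam * ∑ g ∈ grpsOf V, η g →
    ∑ j ∈ varsOf V, (1 / 2) * (u j - γ j) ^ 2 ≤ ∑ j ∈ varsOf V, (1 / 2) * (u j - γ' j) ^ 2

/-- The first part of a call on `V`: the projection step yields `γ`, then the max-flow step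
yields the flow `f`, whose values on the arcs `(j,t)` are the current `ξ̄_j`. -/
def IsFlowStep (η : κ → ℝ) (lam : ℝ) (c : Node p κ → Node p κ → ℝ≥0∞) (u : Fin p → ℝ)
    (V : Finset (Vertex p κ)) (γ : Fin p → ℝ) (f : Node p κ → Node p κ → ℝ) : Prop :=
  IsProjectionStep η lam u V γ ∧ IsMaxFlow (callGraph c V γ) source sink f

/-- `ComputeFlow η lam c u V ξ`: some terminating execution of `computeFlow` on the vertex set `V`
returns `(ξ_j)_{j ∈ V_u}`. Any maximum flow and any minimum cut may be used in each call. -/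
inductive ComputeFlow (η : κ → ℝ) (lam : ℝ) (c : Node p κ → Node p κ → ℝ≥0∞) (u : Fin p → ℝ) :
    Finset (Vertex p κ) → (Fin p → ℝ) → Prop
  | done (V : Finset (Vertex p κ)) (γ : Fin p → ℝ) (f : Node p κ → Node p κ → ℝ)
      (step : IsFlowStep η lam c u V γ f)
      (eq : ∀ j ∈ varsOf V, f (varNode j) sink = γ j) :
      ComputeFlow η lam c u V (fun j => f (varNode j) sink)
  | split (V : Finset (Vertex p κ)) (γ : Fin p → ℝ) (f : Node p κ → Node p κ → ℝ)
      (S : Finset (Node p κ)) (ξp ξm : Fin p → ℝ)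
      (step : IsFlowStep η lam c u V γ f)
      (ne : ∃ j ∈ varsOf V, f (varNode j) sink ≠ γ j)
      (cut : IsMinCut (callGraph c V γ) source sink S)
      (plus : ComputeFlow η lam c u (plusPart V S) ξp)
      (minus : ComputeFlow η lam c u (minusPart V S) ξm) :
      ComputeFlow η lam c u V (fun j => if j ∈ varsOf (plusPart V S) then ξp j else ξm j)

/-- A call on `V` can make a recursive call on `W`. -/
def RecursiveCall (η : κ → ℝ) (lam : ℝ) (c : Node p κ → Node p κ → ℝ≥0∞) (u : Fin p → ℝ)
    (W V : Finset (Vertex p κ)) : Prop :=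
  ∃ γ f S, IsFlowStep η lam c u V γ f ∧ (∃ j ∈ varsOf V, f (varNode j) sink ≠ γ j) ∧
    IsMinCut (callGraph c V γ) source sink S ∧ (W = plusPart V S ∨ W = minusPart V S)

/-- `w` is a possible result of the algorithm on input `u` with initial graph `c`: the signs of the
negative entries of `u` are flipped, `computeFlow` is run on the whole graph, and `u - ξ̄` is
returned, with the signs of `ξ̄` flipped back. For `u ≥ 0` this is `w = u - ξ̄`. -/
def AlgorithmReturns (η : κ → ℝ) (lam : ℝ) (c : Node p κ → Node p κ → ℝ≥0∞) (u w : Fin p → ℝ) :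
    Prop :=
  ∃ ξ, ComputeFlow η lam c (fun j => |u j|) Finset.univ ξ ∧
    w = fun j => u j - (if u j < 0 then -ξ j else ξ j)

end Graphs

/-! ### The proximal operator -/

section Prox

variable {p : ℕ} {κ : Type*} [Fintype κ]

/-- `Ω(w) = ∑_g η_g ‖w_g‖_∞` (the norm of a function on a finite type is the sup norm). -/
noncomputable def Omega (grp : κ → Finset (Fin p)) (η : κ → ℝ) (w : Fin p → ℝ) : ℝ :=
  ∑ g, η g * ‖fun j : {j // j ∈ grp g} => w j‖

noncomputable def proxObjective (grp : κ → Finset (Fin p)) (η : κ → ℝ) (lam : ℝ)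
    (u w : Fin p → ℝ) : ℝ :=
  (1 / 2) * ∑ j, (u j - w j) ^ 2 + lam * Omega grp η w

/-- `w = Prox_{λΩ}(u)`: `w` is the unique minimizer of the proximal objective. -/
def IsProx (grp : κ → Finset (Fin p)) (η : κ → ℝ) (lam : ℝ) (u w : Fin p → ℝ) : Prop :=
  (∀ w', proxObjective grp η lam u w ≤ proxObjective grp η lam u w') ∧
  ∀ v, (∀ w', proxObjective grp η lam u v ≤ proxObjective grp η lam u w') → v = w

end Prox

/-!
Let `ξ` be the flow into the sink and `r = |u| - ξ` the residual, so that `|w| = r`. A set `J` of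
variables can receive flow only through groups that meet it, so `ξ` lies in the polymatroid of the
set function `J ↦ λ ∑_{g ∩ J ≠ ∅} η_g`. If in addition `ξ` meets this bound on every level set
`{t ≤ r}`, `t > 0`, then integrating over `t` gives `⟨ξ, |w|⟩ = λ Ω(w)`, while
`⟨ξ, |w'|⟩ ≤ λ Ω(w')` for all `w'`; hence `u - w` is a subgradient of `λ Ω` at `w`.

A call that returns immediately is tight on level sets because the projection is a soft threshold
at some `τ`: residuals are at most `τ`, and when `τ > 0` the entries that exceed `τ` use up the
whole capacity of the groups. For a call that splits, a maximum flow saturates the minimum cut.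
No group on the source side meets a variable on the sink side, as arcs of infinite capacity do not
cross the cut. The results of the two recursive calls are compared with the flow `φ` of the parent
call. On the source side `φ = (u - τ)₊`, so tightness of the recursive result keeps its residuals
at most `τ`. On the sink side `φ ≤ (u - τ)₊` already exhausts the groups, so the recursive result
exhausts them within `{t ≤ r}` for every `0 < t ≤ τ`. A level set with `t ≤ τ` thus uses up all the
sink-side groups, one with `t > τ` lies on the sink side, and the two results combine to a tight
one. Each split is proper: if the source side held all vertices, every arc into the sink would be
full; if the sink side did, the flow would have the total capacity of the groups and fill these arcs
as well.
-/

section Reachability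

variable {α : Type*} {r : α → α → Prop} {P : α → Prop} {a b : α}

theorem reflTransGen_restrict_of_forall_right (hP : ∀ x y, r x y → P x → P y)
    (h : Relation.ReflTransGen r a b) (ha : P a) :
    Relation.ReflTransGen (fun x y => r x y ∧ P x ∧ P y) a b := by
  suffices Relation.ReflTransGen (fun x y => r x y ∧ P x ∧ P y) a b ∧ P b from this.1
  induction h with
  | refl => exact ⟨.refl, ha⟩
  | tail _ hxy ih => exact ⟨ih.1.tail ⟨hxy, ih.2, hP _ _ hxy ih.2⟩, hP _ _ hxy ih.2⟩

theorem reflTransGen_restrict_of_forall_left (hP : ∀ x y, r x y → P y → P x)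
    (h : Relation.ReflTransGen r a b) (hb : P b) :
    Relation.ReflTransGen (fun x y => r x y ∧ P x ∧ P y) a b := by
  rw [← Relation.reflTransGen_swap] at h ⊢
  exact Relation.ReflTransGen.mono (fun x y hxy => ⟨hxy.1, hxy.2.2, hxy.2.1⟩) _ _
    (reflTransGen_restrict_of_forall_right (fun x y => hP y x) h hb)

theorem exists_nodup_isChain (h : Relation.ReflTransGen r a b) :
    ∃ l : List α, l.Nodup ∧ l.head? = some a ∧ l.getLast? = some b ∧ l.IsChain r := by
  induction h using Relation.ReflTransGen.head_induction_on with
  | refl => exact ⟨[b], by simp⟩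
  | @head a x hax _ ih =>
    obtain ⟨l, hnodup, hhead, hlast, hchain⟩ := ih
    by_cases hal : a ∈ l
    · obtain ⟨l₁, l₂, rfl⟩ := List.append_of_mem hal
      rw [List.getLast?_append_of_ne_nil _ (List.cons_ne_nil a l₂)] at hlast
      exact ⟨a :: l₂, hnodup.of_append_right, rfl, hlast, hchain.right_of_append⟩
    · obtain ⟨l, rfl⟩ := List.head?_eq_some_iff.1 hhead
      exact ⟨a :: x :: l, List.nodup_cons.2 ⟨hal, hnodup⟩, rfl, hlast, hchain.cons_cons hax⟩

theorem reflTransGen_of_isChain {l : List α} (hhead : l.head? = some a)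
    (hlast : l.getLast? = some b) (hchain : l.IsChain r) : Relation.ReflTransGen r a b := by
  obtain ⟨l, rfl⟩ := List.head?_eq_some_iff.1 hhead
  refine List.relationReflTransGen_of_exists_isChain_cons l hchain ?_
  rwa [List.getLast?_eq_some_getLast (List.cons_ne_nil a l), Option.some_inj] at hlast

end Reachability

section FlowTheory

variable {N : Type*} {c : N → N → ℝ≥0∞} {f : N → N → ℝ} {s t : N} {S T : Finset N}

/-- The amount that `f` sends from the nodes of `S` directly to the nodes of `T`. -/
def flowAcross (f : N → N → ℝ) (S T : Finset N) : ℝ :=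
  ∑ a ∈ S, ∑ b ∈ T, f a b

/-- `f` fills every arc leaving `S` and is zero on every arc entering `S`. -/
structure Saturates (c : N → N → ℝ≥0∞) (f : N → N → ℝ) (S : Finset N) : Prop where
  ofReal_eq : ∀ a ∈ S, ∀ b ∉ S, ENNReal.ofReal (f a b) = c a b
  eq_zero : ∀ a ∉ S, ∀ b ∈ S, f a b = 0

/-- The arcs of the residual graph of `f`. -/
def IsResidualArc (c : N → N → ℝ≥0∞) (f : N → N → ℝ) (a b : N) : Prop :=
  ENNReal.ofReal (f a b) < c a b ∨ 0 < f b a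

/-- The directions `δ` in which a small step from `f` respects the capacity constraints: `δ` is
non-negative on the empty arcs and non-positive on the full ones. -/
structure IsFeasibleDirection (c : N → N → ℝ≥0∞) (f δ : N → N → ℝ) : Prop where
  nonneg_of_empty : ∀ a b, f a b ≤ 0 → 0 ≤ δ a b
  nonpos_of_full : ∀ a b, c a b ≤ ENNReal.ofReal (f a b) → δ a b ≤ 0

theorem Saturates.flowAcross_compl_eq_zero [Fintype N] [DecidableEq N] (h : Saturates c f S) :
    flowAcross f Sᶜ S = 0 :=
  Finset.sum_eq_zero fun a ha => Finset.sum_eq_zero fun b hb =>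
    h.eq_zero a (Finset.mem_compl.1 ha) b hb

theorem IsFeasibleDirection.add {δ δ' : N → N → ℝ} (h : IsFeasibleDirection c f δ)
    (h' : IsFeasibleDirection c f δ') : IsFeasibleDirection c f (δ + δ') where
  nonneg_of_empty a b hab := add_nonneg (h.nonneg_of_empty a b hab) (h'.nonneg_of_empty a b hab)
  nonpos_of_full a b hab := add_nonpos (h.nonpos_of_full a b hab) (h'.nonpos_of_full a b hab)

theorem isFeasibleDirection_single [DecidableEq N] {a b : N} {r : ℝ} (hempty : f a b ≤ 0 → 0 ≤ r)
    (hfull : c a b ≤ ENNReal.ofReal (f a b) → r ≤ 0) :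
    IsFeasibleDirection c f (Pi.single a (Pi.single b r)) := by
  constructor <;> intro x y hxy <;> rcases eq_or_ne x a with rfl | hx <;>
    rcases eq_or_ne y b with rfl | hy <;> simp_all

open Filter Topology in
theorem eventually_nonneg_and_ofReal_le {x d : ℝ} {C : ℝ≥0∞} (hx : 0 ≤ x)
    (hxC : ENNReal.ofReal x ≤ C) (hempty : x ≤ 0 → 0 ≤ d) (hfull : C ≤ ENNReal.ofReal x → d ≤ 0) :
    ∀ᶠ ε : ℝ in 𝓝[>] 0, 0 ≤ x + ε * d ∧ ENNReal.ofReal (x + ε * d) ≤ C := by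
  have hlim : Tendsto (fun ε : ℝ => x + ε * d) (𝓝[>] 0) (𝓝 x) := by
    have : ContinuousAt (fun ε : ℝ => x + ε * d) 0 := by fun_prop
    simpa using this.tendsto.mono_left nhdsWithin_le_nhds
  have hpos : ∀ᶠ ε : ℝ in 𝓝[>] 0, 0 < ε := self_mem_nhdsWithin
  refine .and ?_ ?_
  · rcases hx.eq_or_lt with hx0 | hx0
    · filter_upwards [hpos] with ε hε
      exact add_nonneg hx (mul_nonneg hε.le (hempty hx0.ge))
    · exact (hlim.eventually (lt_mem_nhds hx0)).mono fun _ => le_of_lt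
  · rcases hxC.eq_or_lt with hx1 | hx1
    · filter_upwards [hpos] with ε hε
      refine (ENNReal.ofReal_le_ofReal ?_).trans hxC
      exact add_le_of_nonpos_right (mul_nonpos_of_nonneg_of_nonpos hε.le (hfull hx1.ge))
    · have hlim' := (ENNReal.continuous_ofReal.tendsto x).comp hlim
      exact (hlim'.eventually (gt_mem_nhds hx1)).mono fun _ => le_of_lt

theorem eq_of_sum_le_sum_of_le {ι : Type*} {A : Finset ι} {x y : ι → ℝ≥0∞}
    (hxy : ∀ i ∈ A, x i ≤ y i) (htop : ∑ i ∈ A, x i ≠ ⊤) (hsum : ∑ i ∈ A, y i ≤ ∑ i ∈ A, x i) :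
    ∀ i ∈ A, x i = y i := by
  have hsplit : ∑ i ∈ A, x i + ∑ i ∈ A, (y i - x i) = ∑ i ∈ A, y i := by
    rw [← Finset.sum_add_distrib]
    exact Finset.sum_congr rfl fun i hi => add_tsub_cancel_of_le (hxy i hi)
  have hzero : ∑ i ∈ A, (y i - x i) = 0 := by
    rw [← ENNReal.add_right_inj htop, hsplit, add_zero]
    exact hsum.antisymm (Finset.sum_le_sum hxy)
  intro i hi
  exact (hxy i hi).antisymm (tsub_eq_zero_iff_le.1 (Finset.sum_eq_zero_iff.1 hzero i hi))

variable [Fintype N]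

/-- The net outflow of `f` at each node; at the source it is `flowValue`. -/
def divergence : (N → N → ℝ) →ₗ[ℝ] N → ℝ where
  toFun f v := ∑ b, f v b - ∑ a, f a v
  map_add' f g := by
    ext v
    simp only [Pi.add_apply, Finset.sum_add_distrib]
    ring
  map_smul' k f := by
    ext v
    simp only [Pi.smul_apply, smul_eq_mul, ← Finset.mul_sum, RingHom.id_apply]
    ring

theorem flowValue_eq_divergence (s : N) (f : N → N → ℝ) : flowValue s f = divergence f s := rfl

theorem divergence_single [DecidableEq N] (a b : N) (r : ℝ) :
    divergence (Pi.single a (Pi.single b r)) = Pi.single a r - Pi.single b r := by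
  ext v
  have hout : ∑ y, Pi.single (M := fun _ => N → ℝ) a (Pi.single b r) v y
      = Pi.single (M := fun _ => ℝ) a r v := by
    rcases eq_or_ne v a with rfl | hv <;> simp [*]
  have hin : ∑ x, Pi.single (M := fun _ => N → ℝ) a (Pi.single b r) x v
      = Pi.single (M := fun _ => ℝ) b r v := by
    rw [Fintype.sum_eq_single a fun x hx => by simp [hx], Pi.single_eq_same]
  exact congrArg₂ (· - ·) hout hin

namespace IsFlow

theorem zero (c : N → N → ℝ≥0∞) (s t : N) : IsFlow c s t 0 := ⟨by simp, by simp, by simp⟩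

theorem mono {c' : N → N → ℝ≥0∞} (hf : IsFlow c s t f) (hcc' : ∀ a b, c a b ≤ c' a b) :
    IsFlow c' s t f :=
  ⟨hf.nonneg, fun a b => (hf.le_cap a b).trans (hcc' a b), hf.conserved⟩

theorem eq_zero_of_capacity_eq_zero (hf : IsFlow c s t f) {a b : N} (hab : c a b = 0) :
    f a b = 0 :=
  (ENNReal.ofReal_eq_zero.1 (nonpos_iff_eq_zero.1 (hab ▸ hf.le_cap a b))).antisymm (hf.nonneg a b)

theorem divergence_eq_zero (hf : IsFlow c s t f) {v : N} (hs : v ≠ s) (ht : v ≠ t) :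
    divergence f v = 0 :=
  sub_eq_zero.2 (hf.conserved v hs ht).symm

theorem sum_divergence_eq_zero (hf : IsFlow c s t f) (hs : s ∉ T) (ht : t ∉ T) :
    ∑ v ∈ T, divergence f v = 0 :=
  Finset.sum_eq_zero fun _ hv =>
    hf.divergence_eq_zero (ne_of_mem_of_not_mem hv hs) (ne_of_mem_of_not_mem hv ht)

theorem flowAcross_nonneg (hf : IsFlow c s t f) (S T : Finset N) : 0 ≤ flowAcross f S T :=
  Finset.sum_nonneg fun a _ => Finset.sum_nonneg fun b _ => hf.nonneg a b

theorem ofReal_flowAcross (hf : IsFlow c s t f) (S T : Finset N) :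
    ENNReal.ofReal (flowAcross f S T) = ∑ a ∈ S, ∑ b ∈ T, ENNReal.ofReal (f a b) := by
  rw [flowAcross,
    ENNReal.ofReal_sum_of_nonneg fun a _ => Finset.sum_nonneg fun b _ => hf.nonneg a b]
  exact Finset.sum_congr rfl fun a _ => ENNReal.ofReal_sum_of_nonneg fun b _ => hf.nonneg a b

theorem exists_pos_isFlow_add_smul {δ : N → N → ℝ} (hf : IsFlow c s t f)
    (hδ : IsFeasibleDirection c f δ) (hcons : ∀ v, v ≠ s → v ≠ t → divergence δ v = 0) :
    ∃ ε > (0 : ℝ), IsFlow c s t (f + ε • δ) := by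
  have hsmall := Filter.eventually_all.2 fun a => Filter.eventually_all.2 fun b =>
    eventually_nonneg_and_ofReal_le (hf.nonneg a b) (hf.le_cap a b) (hδ.nonneg_of_empty a b)
      (hδ.nonpos_of_full a b)
  obtain ⟨ε, hbounds, hε⟩ := (hsmall.and self_mem_nhdsWithin).exists
  refine ⟨ε, hε, fun a b => (hbounds a b).1, fun a b => (hbounds a b).2, fun v hs ht => ?_⟩
  have hdiv : divergence (f + ε • δ) v = 0 := by
    simp [hf.divergence_eq_zero hs ht, hcons v hs ht]
  exact (sub_eq_zero.1 hdiv).symm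

end IsFlow

theorem IsMaxFlow.divergence_nonpos {δ : N → N → ℝ} (hf : IsMaxFlow c s t f)
    (hδ : IsFeasibleDirection c f δ) (hcons : ∀ v, v ≠ s → v ≠ t → divergence δ v = 0) :
    divergence δ s ≤ 0 := by
  obtain ⟨ε, hε, hflow⟩ := hf.1.exists_pos_isFlow_add_smul hδ hcons
  have hle := hf.2 _ hflow
  simp only [flowValue_eq_divergence, map_add, map_smul, Pi.add_apply, Pi.smul_apply,
    smul_eq_mul] at hle
  have hε_mul : ε * divergence δ s ≤ 0 := by linarith
  exact nonpos_of_mul_nonpos_right hε_mul hε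

theorem IsMaxFlow.flowValue_nonneg (hf : IsMaxFlow c s t f) : 0 ≤ flowValue s f := by
  simpa [flowValue] using hf.2 0 (.zero c s t)

theorem exists_isMaxFlow_of_forall_ne_top (hc : ∀ a b, c a b ≠ ⊤) (s t : N) :
    ∃ f, IsMaxFlow c s t f := by
  have hset : {f | IsFlow c s t f} = Set.Icc 0 (fun a b => (c a b).toReal) ∩
      ⋂ v, ⋂ (_ : v ≠ s), ⋂ (_ : v ≠ t), {f | ∑ a, f a v = ∑ b, f v b} := by
    ext f
    simp only [Set.mem_ofPred_eq, Set.mem_inter_iff, Set.mem_Icc, Set.mem_iInter, Pi.le_def,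
      Pi.zero_apply, ← ENNReal.ofReal_le_iff_le_toReal (hc _ _)]
    exact ⟨fun h => ⟨⟨h.nonneg, h.le_cap⟩, h.conserved⟩, fun h => ⟨h.1.1, h.1.2, h.2⟩⟩
  have hcompact : IsCompact {f | IsFlow c s t f} := by
    rw [hset]
    refine isCompact_Icc.inter_right ?_
    refine isClosed_iInter fun v => isClosed_iInter fun _ => isClosed_iInter fun _ => ?_
    exact isClosed_eq (by fun_prop) (by fun_prop)
  obtain ⟨f, hf, hmax⟩ := hcompact.exists_isMaxOn ⟨0, .zero c s t⟩
    (f := flowValue s) (by unfold flowValue; fun_prop)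
  exact ⟨f, hf, fun f' hf' => hmax hf'⟩

variable [DecidableEq N]

theorem sum_divergence (f : N → N → ℝ) (S : Finset N) :
    ∑ v ∈ S, divergence f v = flowAcross f S Sᶜ - flowAcross f Sᶜ S := by
  have hout : ∑ v ∈ S, ∑ b, f v b = flowAcross f S S + flowAcross f S Sᶜ := by
    simp only [flowAcross, ← Finset.sum_add_distrib, Finset.sum_add_sum_compl]
  have hin : ∑ v ∈ S, ∑ a, f a v = flowAcross f S S + flowAcross f Sᶜ S := by
    simp only [flowAcross, Finset.sum_add_sum_compl S fun a => ∑ b ∈ S, f a b]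
    exact Finset.sum_comm
  change ∑ v ∈ S, (∑ b, f v b - ∑ a, f a v) = _
  rw [Finset.sum_sub_distrib, hout, hin]
  ring

theorem IsResidualArc.exists_isFeasibleDirection {a b : N} (hab : IsResidualArc c f a b) :
    ∃ δ, IsFeasibleDirection c f δ ∧ divergence δ = Pi.single a 1 - Pi.single b 1 := by
  rcases hab with hab | hab
  · exact ⟨_, isFeasibleDirection_single (fun _ => zero_le_one) fun h => absurd hab h.not_gt,
      divergence_single a b 1⟩
  · refine ⟨_, isFeasibleDirection_single (fun h => absurd hab h.not_gt)
      (fun _ => neg_one_lt_zero.le), (divergence_single b a (-1)).trans ?_⟩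
    rw [Pi.single_neg, Pi.single_neg, neg_sub_neg]

theorem exists_isFeasibleDirection_of_reachable {a b : N}
    (h : Relation.ReflTransGen (IsResidualArc c f) a b) :
    ∃ δ, IsFeasibleDirection c f δ ∧ divergence δ = Pi.single a 1 - Pi.single b 1 := by
  induction h with
  | refl => exact ⟨0, ⟨fun _ _ _ => le_rfl, fun _ _ _ => le_rfl⟩, by simp⟩
  | tail _ hxy ih =>
    obtain ⟨δ, hδ, hdiv⟩ := ih
    obtain ⟨δ', hδ', hdiv'⟩ := hxy.exists_isFeasibleDirection
    exact ⟨δ + δ', hδ.add hδ', by rw [map_add, hdiv, hdiv', sub_add_sub_cancel]⟩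

omit [DecidableEq N] in
theorem IsMaxFlow.not_reachable (hf : IsMaxFlow c s t f) (hst : s ≠ t) :
    ¬ Relation.ReflTransGen (IsResidualArc c f) s t := by
  classical
  intro h
  obtain ⟨δ, hδ, hdiv⟩ := exists_isFeasibleDirection_of_reachable h
  have hs := hf.divergence_nonpos hδ fun v hvs hvt => by simp [hdiv, hvs, hvt]
  simp only [hdiv, Pi.sub_apply, Pi.single_eq_same, Pi.single_eq_of_ne hst, sub_zero] at hs
  exact hs.not_gt zero_lt_one

omit [DecidableEq N] in
theorem IsMaxFlow.exists_saturates (hf : IsMaxFlow c s t f) (hst : s ≠ t) :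
    ∃ S : Finset N, s ∈ S ∧ t ∉ S ∧ Saturates c f S := by
  classical
  let S := Finset.univ.filter (Relation.ReflTransGen (IsResidualArc c f) s)
  have hS : ∀ v, v ∈ S ↔ Relation.ReflTransGen (IsResidualArc c f) s v := fun v => by simp [S]
  have hclosed : ∀ a ∈ S, ∀ b ∉ S, ¬ IsResidualArc c f a b := fun a ha b hb hab =>
    hb ((hS b).2 (((hS a).1 ha).tail hab))
  refine ⟨S, (hS s).2 .refl, mt (hS t).1 (hf.not_reachable hst), fun a ha b hb => ?_,
    fun a ha b hb => ?_⟩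
  · exact (hf.1.le_cap a b).antisymm (not_lt.1 fun h => hclosed a ha b hb (.inl h))
  · exact (not_lt.1 fun h => hclosed b hb a ha (.inr h)).antisymm (hf.1.nonneg a b)

namespace IsFlow

theorem flowValue_eq (hf : IsFlow c s t f) (hs : s ∈ S) (ht : t ∉ S) :
    flowValue s f = flowAcross f S Sᶜ - flowAcross f Sᶜ S := by
  rw [← sum_divergence, flowValue_eq_divergence, Finset.sum_eq_single_of_mem s hs]
  exact fun v hv hvs => hf.divergence_eq_zero hvs (ne_of_mem_of_not_mem hv ht)

theorem ofReal_flowAcross_le_cutCapacity (hf : IsFlow c s t f) (S : Finset N) :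
    ENNReal.ofReal (flowAcross f S Sᶜ) ≤ cutCapacity c S := by
  rw [hf.ofReal_flowAcross]
  exact Finset.sum_le_sum fun a _ => Finset.sum_le_sum fun b _ => hf.le_cap a b

theorem ofReal_flowValue_le_cutCapacity (hf : IsFlow c s t f) (hs : s ∈ S) (ht : t ∉ S) :
    ENNReal.ofReal (flowValue s f) ≤ cutCapacity c S := by
  rw [hf.flowValue_eq hs ht]
  exact (ENNReal.ofReal_le_ofReal (sub_le_self _ (hf.flowAcross_nonneg _ _))).trans
    (hf.ofReal_flowAcross_le_cutCapacity S)

theorem flowValue_eq_of_saturates (hf : IsFlow c s t f) (hs : s ∈ S) (ht : t ∉ S)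
    (h : Saturates c f S) : flowValue s f = flowAcross f S Sᶜ := by
  rw [hf.flowValue_eq hs ht, h.flowAcross_compl_eq_zero, sub_zero]

theorem cutCapacity_eq_of_saturates (hf : IsFlow c s t f) (hs : s ∈ S) (ht : t ∉ S)
    (h : Saturates c f S) : cutCapacity c S = ENNReal.ofReal (flowValue s f) := by
  rw [hf.flowValue_eq_of_saturates hs ht h, hf.ofReal_flowAcross]
  exact Finset.sum_congr rfl fun a ha => Finset.sum_congr rfl fun b hb =>
    (h.ofReal_eq a ha b (Finset.mem_compl.1 hb)).symm

theorem saturates_of_cutCapacity_le (hf : IsFlow c s t f) (hs : s ∈ S) (ht : t ∉ S)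
    (hvalue : 0 ≤ flowValue s f) (hcut : cutCapacity c S ≤ ENNReal.ofReal (flowValue s f)) :
    Saturates c f S := by
  have hforward : flowAcross f S Sᶜ ≤ flowValue s f := (ENNReal.ofReal_le_ofReal_iff hvalue).1
    ((hf.ofReal_flowAcross_le_cutCapacity S).trans hcut)
  have hback : flowAcross f Sᶜ S = 0 :=
    le_antisymm (by linarith [hf.flowValue_eq hs ht]) (hf.flowAcross_nonneg _ _)
  constructor
  · have hfill : ∑ e ∈ S ×ˢ Sᶜ, c e.1 e.2 ≤ ∑ e ∈ S ×ˢ Sᶜ, ENNReal.ofReal (f e.1 e.2) := by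
      rw [Finset.sum_product, Finset.sum_product, ← hf.ofReal_flowAcross]
      refine hcut.trans (ENNReal.ofReal_le_ofReal ?_)
      linarith [hf.flowValue_eq hs ht]
    intro a ha b hb
    exact eq_of_sum_le_sum_of_le (fun e _ => hf.le_cap e.1 e.2)
      (ENNReal.sum_ne_top.2 fun e _ => ENNReal.ofReal_ne_top) hfill (a, b)
      (Finset.mk_mem_product ha (Finset.mem_compl.2 hb))
  · rw [flowAcross, ← Finset.sum_product',
      Finset.sum_eq_zero_iff_of_nonneg fun e _ => hf.nonneg e.1 e.2] at hback
    exact fun a ha b hb => hback (a, b) (Finset.mk_mem_product (Finset.mem_compl.2 ha) hb)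

omit [DecidableEq N] in
theorem isMaxFlow_of_saturates (hf : IsFlow c s t f) (hs : s ∈ S) (ht : t ∉ S)
    (h : Saturates c f S) : IsMaxFlow c s t f := by
  classical
  refine ⟨hf, fun f' hf' => ?_⟩
  have hvalue : 0 ≤ flowValue s f :=
    (hf.flowValue_eq_of_saturates hs ht h).symm ▸ hf.flowAcross_nonneg _ _
  rw [← ENNReal.ofReal_le_ofReal_iff hvalue, ← hf.cutCapacity_eq_of_saturates hs ht h]
  exact hf'.ofReal_flowValue_le_cutCapacity hs ht

omit [DecidableEq N] in
theorem sum_sink_le_sum_source (hf : IsFlow c s t f) (hs : s ∉ T) (ht : t ∉ T)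
    (hT : ∀ a ∉ T, ∀ b ∈ T, a ≠ s → f a b = 0) : ∑ v ∈ T, f v t ≤ ∑ v ∈ T, f s v := by
  classical
  have hin : flowAcross f Tᶜ T = ∑ v ∈ T, f s v :=
    Finset.sum_eq_single_of_mem s (Finset.mem_compl.2 hs) fun a ha has =>
      Finset.sum_eq_zero fun b hb => hT a (Finset.mem_compl.1 ha) b hb has
  have hout : ∑ v ∈ T, f v t ≤ flowAcross f T Tᶜ := Finset.sum_le_sum fun v _ =>
    Finset.single_le_sum (fun b _ => hf.nonneg v b) (Finset.mem_compl.2 ht)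
  linarith [sum_divergence f T, hf.sum_divergence_eq_zero hs ht]

omit [DecidableEq N] in
theorem sum_source_le_sum_sink (hf : IsFlow c s t f) (hs : s ∉ T) (ht : t ∉ T)
    (hT : ∀ a ∈ T, ∀ b ∉ T, b ≠ t → f a b = 0) : ∑ v ∈ T, f s v ≤ ∑ v ∈ T, f v t := by
  classical
  have hout : flowAcross f T Tᶜ = ∑ v ∈ T, f v t := Finset.sum_congr rfl fun a ha =>
    Finset.sum_eq_single_of_mem t (Finset.mem_compl.2 ht) fun b hb =>
      hT a ha b (Finset.mem_compl.1 hb)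
  have hin : ∑ v ∈ T, f s v ≤ flowAcross f Tᶜ T :=
    Finset.single_le_sum (f := fun a => ∑ v ∈ T, f a v)
      (fun a _ => Finset.sum_nonneg fun b _ => hf.nonneg a b) (Finset.mem_compl.2 hs)
  linarith [sum_divergence f T, hf.sum_divergence_eq_zero hs ht]

end IsFlow

theorem IsMaxFlow.saturates_of_isMinCut (hf : IsMaxFlow c s t f) (hS : IsMinCut c s t S) :
    Saturates c f S := by
  obtain ⟨hs, ht, hmin⟩ := hS
  obtain ⟨S₀, hs₀, ht₀, hsat⟩ := hf.exists_saturates (ne_of_mem_of_not_mem hs ht)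
  refine hf.1.saturates_of_cutCapacity_le hs ht hf.flowValue_nonneg ?_
  exact (hmin S₀ hs₀ ht₀).trans_eq (hf.1.cutCapacity_eq_of_saturates hs₀ ht₀ hsat)

theorem exists_isMinCut (c : N → N → ℝ≥0∞) (hst : s ≠ t) : ∃ S, IsMinCut c s t S := by
  obtain ⟨S, hS, hmin⟩ := Finset.exists_min_image
    (Finset.univ.filter fun S : Finset N => s ∈ S ∧ t ∉ S) (cutCapacity c)
    ⟨{s}, by simpa using hst.symm⟩
  simp only [Finset.mem_filter_univ] at hS hmin
  exact ⟨S, hS.1, hS.2, fun S' h1 h2 => hmin S' ⟨h1, h2⟩⟩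

/-- Infinite capacities are truncated above the capacity of a finite cut: a cut saturated by a
maximum flow of the truncated network contains no truncated arc. -/
theorem exists_isMaxFlow (hs : s ∈ S) (ht : t ∉ S) (hfin : cutCapacity c S ≠ ⊤) :
    ∃ f, IsMaxFlow c s t f := by
  set M := cutCapacity c S + 1
  have hM : M ≠ ⊤ := ENNReal.add_ne_top.2 ⟨hfin, ENNReal.one_ne_top⟩
  obtain ⟨f, hf⟩ := exists_isMaxFlow_of_forall_ne_top (c := fun a b => min (c a b) M)
    (fun a b => ne_top_of_le_ne_top hM (min_le_right _ _)) s t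
  obtain ⟨S', hs', ht', hsat⟩ := hf.exists_saturates (ne_of_mem_of_not_mem hs ht)
  have hfc : IsFlow c s t f := hf.1.mono fun a b => min_le_left _ _
  have hcut : cutCapacity (fun a b => min (c a b) M) S' < M := by
    rw [hf.1.cutCapacity_eq_of_saturates hs' ht' hsat]
    exact (hfc.ofReal_flowValue_le_cutCapacity hs ht).trans_lt
      (ENNReal.lt_add_right hfin one_ne_zero)
  refine ⟨f, hfc.isMaxFlow_of_saturates hs' ht' ⟨fun a ha b hb => ?_, hsat.eq_zero⟩⟩
  have harc : min (c a b) M < M := by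
    refine lt_of_le_of_lt ?_ hcut
    exact (Finset.single_le_sum (f := fun b => min (c a b) M) (fun _ _ => zero_le)
      (Finset.mem_compl.2 hb)).trans (Finset.single_le_sum
        (f := fun a => ∑ b ∈ S'ᶜ, min (c a b) M) (fun _ _ => zero_le) ha)
  rw [hsat.ofReal_eq a ha b hb,
    min_eq_left ((min_lt_iff.1 harc).resolve_right (lt_irrefl _)).le]

end FlowTheory

section SoftThreshold

variable {ι : Type*} {J : Finset ι} {u : ι → ℝ} {R τ : ℝ}

/-- `τ` is a multiplier for the projection of `u` onto the `ℓ¹`-ball of radius `R` over the index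
set `J`: the soft-thresholded vector is feasible and satisfies complementary slackness. -/
structure IsThreshold (J : Finset ι) (u : ι → ℝ) (R τ : ℝ) : Prop where
  nonneg : 0 ≤ τ
  sum_le : ∑ j ∈ J, max (u j - τ) 0 ≤ R
  eq_zero_or_sum_eq : τ = 0 ∨ ∑ j ∈ J, max (u j - τ) 0 = R

theorem exists_isThreshold (J : Finset ι) (u : ι → ℝ) (hR : 0 ≤ R) : ∃ τ, IsThreshold J u R τ := by
  rcases le_or_gt (∑ j ∈ J, max (u j - 0) 0) R with h | h
  · exact ⟨0, le_rfl, h, .inl rfl⟩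
  · have hcont : Continuous fun τ : ℝ => ∑ j ∈ J, max (u j - τ) 0 := by fun_prop
    have hend : ∑ j ∈ J, max (u j - ∑ i ∈ J, |u i|) 0 = 0 :=
      Finset.sum_eq_zero fun j hj => max_eq_right (sub_nonpos.2 ((le_abs_self _).trans
        (Finset.single_le_sum (f := fun i => |u i|) (fun i _ => abs_nonneg _) hj)))
    obtain ⟨τ, hτ, hval⟩ := intermediate_value_Icc'
      (Finset.sum_nonneg fun i (_ : i ∈ J) => abs_nonneg (u i)) hcont.continuousOn
      (Set.mem_Icc.2 ⟨hend.trans_le hR, h.le⟩)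
    exact ⟨τ, hτ.1, hval.le, .inr hval⟩

theorem sq_add_sq_soft_threshold_le {x y τ : ℝ} (hx : 0 ≤ x) (hτ : 0 ≤ τ) :
    (1 / 2) * (x - max (x - τ) 0) ^ 2 + (1 / 2) * (y - max (x - τ) 0) ^ 2 +
      τ * (max (x - τ) 0 - |y|) ≤ (1 / 2) * (x - y) ^ 2 := by
  have hy := le_abs_self y
  rcases le_total (x - τ) 0 with h | h
  · rw [max_eq_right h]
    nlinarith [mul_nonneg (sub_nonneg.2 (sub_nonpos.1 h)) (abs_nonneg y),
      mul_nonneg hx (sub_nonneg.2 hy)]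
  · rw [max_eq_left h]
    nlinarith [mul_nonneg hτ (sub_nonneg.2 hy)]

theorem IsThreshold.sum_sq_add_sum_sq_le (h : IsThreshold J u R τ) (hu : ∀ j ∈ J, 0 ≤ u j)
    {γ : ι → ℝ} (hγ : ∑ j ∈ J, |γ j| ≤ R) :
    ∑ j ∈ J, (1 / 2) * (u j - max (u j - τ) 0) ^ 2 +
      ∑ j ∈ J, (1 / 2) * (γ j - max (u j - τ) 0) ^ 2 ≤ ∑ j ∈ J, (1 / 2) * (u j - γ j) ^ 2 := by
  have hpointwise := Finset.sum_le_sum fun j hj =>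
    sq_add_sq_soft_threshold_le (y := γ j) (hu j hj) h.nonneg
  simp only [Finset.sum_add_distrib, ← Finset.mul_sum, Finset.sum_sub_distrib] at hpointwise ⊢
  have hslack : 0 ≤ τ * (∑ j ∈ J, max (u j - τ) 0 - ∑ j ∈ J, |γ j|) := by
    rcases h.eq_zero_or_sum_eq with hτ | hsum
    · simp [hτ]
    · exact mul_nonneg h.nonneg (by linarith)
  linarith

end SoftThreshold

section LayerCake

open MeasureTheory

variable {ι κ : Type*}

theorem integrable_indicator_Ioc_const (x r : ℝ) :
    Integrable ((Set.Ioc 0 x).indicator fun _ => r) := by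
  refine IntegrableOn.integrable_indicator ?_ measurableSet_Ioc
  exact integrableOn_const measure_Ioc_lt_top.ne

theorem integral_sum_indicator_Ioc {I : Finset ι} {x : ι → ℝ} (hx : ∀ i ∈ I, 0 ≤ x i)
    (r : ι → ℝ) :
    ∫ t, ∑ i ∈ I, (Set.Ioc 0 (x i)).indicator (fun _ => r i) t = ∑ i ∈ I, r i * x i := by
  rw [integral_finsetSum _ fun i _ => integrable_indicator_Ioc_const (x i) (r i)]
  refine Finset.sum_congr rfl fun i hi => ?_
  rw [integral_indicator_const _ measurableSet_Ioc, Real.volume_real_Ioc_of_le (hx i hi), sub_zero,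
    smul_eq_mul, mul_comm]

/-- Layer cake: each side is the integral over `t > 0` of the corresponding sum over the level
sets. -/
theorem sum_mul_le_sum_mul_of_level_sums_le {I : Finset ι} {K : Finset κ} {r x : ι → ℝ}
    {q y : κ → ℝ} (hx : ∀ i ∈ I, 0 ≤ x i) (hy : ∀ k ∈ K, 0 ≤ y k)
    (h : ∀ t, 0 < t → ∑ i ∈ I with t ≤ x i, r i ≤ ∑ k ∈ K with t ≤ y k, q k) :
    ∑ i ∈ I, r i * x i ≤ ∑ k ∈ K, q k * y k := by
  rw [← integral_sum_indicator_Ioc hx, ← integral_sum_indicator_Ioc hy]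
  refine integral_mono (integrable_finsetSum _ fun i _ => integrable_indicator_Ioc_const _ _)
    (integrable_finsetSum _ fun k _ => integrable_indicator_Ioc_const _ _) fun t => ?_
  rcases le_or_gt t 0 with ht | ht
  · simp [ht.not_gt]
  · simpa [Set.indicator_apply, ht, Finset.sum_filter] using h t ht

end LayerCake

section LevelTight

variable {ι κ : Type*} [DecidableEq ι] {grp : κ → Finset ι} {a : κ → ℝ} {u ξ φ : ι → ℝ} {τ : ℝ}
  {H H' : Finset κ} {A B J J' : Finset ι}

/-- The total weight of the groups of `H` that meet `J`. -/
def coverWeight (grp : κ → Finset ι) (a : κ → ℝ) (H : Finset κ) (J : Finset ι) : ℝ :=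
  ∑ g ∈ H with ∃ j ∈ J, j ∈ grp g, a g

/-- On `A`, the vector `ξ` satisfies the inequalities that define the polymatroid of
`coverWeight`. -/
def IsCoverBounded (grp : κ → Finset ι) (a : κ → ℝ) (H : Finset κ) (A : Finset ι) (ξ : ι → ℝ) :
    Prop :=
  ∀ J ⊆ A, ∑ j ∈ J, ξ j ≤ coverWeight grp a H J

/-- On `A`, the vector `ξ` lies in the polymatroid of the groups of `H` and meets its bound on every
level set of the residual `u - ξ ≥ 0`. For `ξ = u - w` with all variables and groups, and with `a`
the weights of the norm, this is the optimality condition of the proximal problem. -/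
structure IsLevelTight (grp : κ → Finset ι) (a : κ → ℝ) (u : ι → ℝ) (H : Finset κ) (A : Finset ι)
    (ξ : ι → ℝ) : Prop where
  nonneg : ∀ j ∈ A, 0 ≤ ξ j
  le : ∀ j ∈ A, ξ j ≤ u j
  coverBounded : IsCoverBounded grp a H A ξ
  tight : ∀ t, 0 < t →
    coverWeight grp a H (A.filter fun j => t ≤ u j - ξ j) ≤ ∑ j ∈ A with t ≤ u j - ξ j, ξ j

theorem coverWeight_empty : coverWeight grp a H ∅ = 0 := by simp [coverWeight]

theorem coverWeight_le_sum (ha : ∀ g, 0 ≤ a g) : coverWeight grp a H J ≤ ∑ g ∈ H, a g :=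
  Finset.sum_le_sum_of_subset_of_nonneg (Finset.filter_subset _ _) fun g _ _ => ha g

theorem sum_le_coverWeight (ha : ∀ g, 0 ≤ a g)
    (h : ∀ g ∈ H', g ∈ H ∧ ∃ j ∈ J, j ∈ grp g) :
    ∑ g ∈ H', a g ≤ coverWeight grp a H J :=
  Finset.sum_le_sum_of_subset_of_nonneg (fun g hg => Finset.mem_filter.2 (h g hg)) fun g _ _ => ha g

theorem coverWeight_le_coverWeight (ha : ∀ g, 0 ≤ a g)
    (h : ∀ g ∈ H, ∀ j ∈ J, j ∈ grp g → g ∈ H' ∧ ∃ i ∈ J', i ∈ grp g) :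
    coverWeight grp a H J ≤ coverWeight grp a H' J' := by
  refine sum_le_coverWeight ha fun g hg => ?_
  obtain ⟨hgH, j, hj, hjg⟩ := Finset.mem_filter.1 hg
  exact h g hgH j hj hjg

theorem coverWeight_mono (ha : ∀ g, 0 ≤ a g) (hJ : J ⊆ J') :
    coverWeight grp a H J ≤ coverWeight grp a H J' :=
  coverWeight_le_coverWeight ha fun _ hg j hj hjg => ⟨hg, j, hJ hj, hjg⟩

theorem coverWeight_union [DecidableEq κ] (h : Disjoint H H') :
    coverWeight grp a (H ∪ H') J = coverWeight grp a H J + coverWeight grp a H' J := by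
  rw [coverWeight, Finset.filter_union, Finset.sum_union (Finset.disjoint_filter_filter h)]
  rfl

theorem IsCoverBounded.congr (h : IsCoverBounded grp a H A ξ) (he : ∀ j ∈ A, φ j = ξ j) :
    IsCoverBounded grp a H A φ := fun J hJ =>
  (Finset.sum_congr rfl fun j hj => he j (hJ hj)).trans_le (h J hJ)

theorem IsCoverBounded.union [DecidableEq κ] (ha : ∀ g, 0 ≤ a g) (hH : Disjoint H H')
    (hAB : Disjoint A B) (hA : IsCoverBounded grp a H A ξ) (hB : IsCoverBounded grp a H' B ξ) :
    IsCoverBounded grp a (H ∪ H') (A ∪ B) ξ := by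
  intro J hJ
  have hJ_split : J ∩ A ∪ J ∩ B = J := by
    rw [← Finset.inter_union_distrib_left, Finset.inter_eq_left.2 hJ]
  have hdisj : Disjoint (J ∩ A) (J ∩ B) :=
    hAB.mono Finset.inter_subset_right Finset.inter_subset_right
  calc ∑ j ∈ J, ξ j = ∑ j ∈ J ∩ A, ξ j + ∑ j ∈ J ∩ B, ξ j := by
        rw [← Finset.sum_union hdisj, hJ_split]
    _ ≤ coverWeight grp a H (J ∩ A) + coverWeight grp a H' (J ∩ B) :=
        add_le_add (hA _ Finset.inter_subset_right) (hB _ Finset.inter_subset_right)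
    _ ≤ coverWeight grp a H J + coverWeight grp a H' J :=
        add_le_add (coverWeight_mono ha Finset.inter_subset_left)
          (coverWeight_mono ha Finset.inter_subset_left)
    _ = coverWeight grp a (H ∪ H') J := (coverWeight_union hH).symm

namespace IsLevelTight

theorem congr (h : IsLevelTight grp a u H A ξ) (he : ∀ j ∈ A, φ j = ξ j) :
    IsLevelTight grp a u H A φ where
  nonneg j hj := he j hj ▸ h.nonneg j hj
  le j hj := he j hj ▸ h.le j hj
  coverBounded := h.coverBounded.congr he
  tight t ht := by
    have hlevel : (A.filter fun j => t ≤ u j - φ j) = A.filter fun j => t ≤ u j - ξ j :=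
      Finset.filter_congr fun j hj => by rw [he j hj]
    rw [hlevel, Finset.sum_congr rfl fun j hj => he j (Finset.mem_of_mem_filter j hj)]
    exact h.tight t ht

theorem of_soft_threshold (ha : ∀ g, 0 ≤ a g) (hu : ∀ j ∈ A, 0 ≤ u j)
    (hτ : IsThreshold A u (∑ g ∈ H, a g) τ)
    (hcover : IsCoverBounded grp a H A fun j => max (u j - τ) 0) :
    IsLevelTight grp a u H A fun j => max (u j - τ) 0 where
  nonneg j _ := le_max_right _ _
  le j hj := max_le (sub_le_self _ hτ.nonneg) (hu j hj)
  coverBounded := hcover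
  tight t ht := by
    rcases (A.filter fun j => t ≤ u j - max (u j - τ) 0).eq_empty_or_nonempty with hL | ⟨i, hi⟩
    · rw [hL, coverWeight_empty, Finset.sum_empty]
    have htτ : t ≤ τ := by linarith [(Finset.mem_filter.1 hi).2, le_max_left (u i - τ) 0]
    have hoff : ∀ j ∈ A, ¬ t ≤ u j - max (u j - τ) 0 → max (u j - τ) 0 ≤ 0 := by
      intro j _ hj
      by_contra! hpos
      rw [max_eq_left_of_lt (lt_max_iff.1 hpos |>.resolve_right (lt_irrefl _))] at hj
      exact hj (by linarith)
    refine (coverWeight_le_sum ha).trans ?_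
    rw [← hτ.eq_zero_or_sum_eq.resolve_left (ht.trans_le htτ).ne', Finset.sum_filter]
    refine Finset.sum_le_sum fun j hj => ?_
    split_ifs with h
    exacts [le_rfl, hoff j hj h]

theorem residual_le (h : IsLevelTight grp a u H A ξ) (hτ : 0 ≤ τ) (hφ : ∀ j ∈ A, u j - τ ≤ φ j)
    (hcover : IsCoverBounded grp a H A φ) : ∀ j ∈ A, u j - ξ j ≤ τ := by
  intro j hj
  by_contra! hlt
  have hstrict : ∑ k ∈ A with u j - ξ j ≤ u k - ξ k, ξ k <
      ∑ k ∈ A with u j - ξ j ≤ u k - ξ k, φ k := by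
    refine Finset.sum_lt_sum_of_nonempty ⟨j, Finset.mem_filter.2 ⟨hj, le_rfl⟩⟩ fun k hk => ?_
    obtain ⟨hkA, hk⟩ := Finset.mem_filter.1 hk
    linarith [hφ k hkA]
  exact hstrict.not_ge ((hcover _ (Finset.filter_subset _ A)).trans (h.tight _ (hτ.trans_lt hlt)))

theorem le_residual (ha : ∀ g, 0 ≤ a g) (h : IsLevelTight grp a u H A ξ)
    (hφ : ∀ j ∈ A, φ j ≤ max (u j - τ) 0) (hcover : IsCoverBounded grp a H A φ)
    (htotal : ∑ g ∈ H, a g ≤ ∑ j ∈ A, φ j) : ∀ j ∈ A, τ < u j → τ ≤ u j - ξ j := by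
  intro j hj hju
  by_contra! hlt
  have hτ : 0 < τ := by linarith [h.le j hj]
  have hon : ∑ k ∈ A with τ ≤ u k - ξ k, φ k ≤ ∑ k ∈ A with τ ≤ u k - ξ k, ξ k :=
    (hcover _ (Finset.filter_subset _ A)).trans (h.tight τ hτ)
  have hoff : ∑ k ∈ A with ¬ τ ≤ u k - ξ k, φ k < ∑ k ∈ A with ¬ τ ≤ u k - ξ k, ξ k := by
    refine Finset.sum_lt_sum (fun k hk => ?_) ⟨j, Finset.mem_filter.2 ⟨hj, not_le.2 hlt⟩, ?_⟩
    · obtain ⟨hkA, hk⟩ := Finset.mem_filter.1 hk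
      exact (hφ k hkA).trans (max_le (by linarith) (h.nonneg k hkA))
    · exact (hφ j hj).trans_lt (max_lt (by linarith) (by linarith [h.le j hj]))
  have hle : ∑ j ∈ A, ξ j ≤ ∑ g ∈ H, a g :=
    (h.coverBounded A subset_rfl).trans (coverWeight_le_sum ha)
  linarith [Finset.sum_filter_add_sum_filter_not A (fun j => τ ≤ u j - ξ j) ξ,
    Finset.sum_filter_add_sum_filter_not A (fun j => τ ≤ u j - ξ j) φ]

theorem sum_le_sum_level (ha : ∀ g, 0 ≤ a g) (h : IsLevelTight grp a u H A ξ)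
    (hφ : ∀ j ∈ A, φ j ≤ max (u j - τ) 0) (hcover : IsCoverBounded grp a H A φ)
    (htotal : ∑ g ∈ H, a g ≤ ∑ j ∈ A, φ j) {t : ℝ} (ht : 0 < t) (htτ : t ≤ τ) :
    ∑ g ∈ H, a g ≤ ∑ j ∈ A with t ≤ u j - ξ j, ξ j := by
  have hoff : ∀ j ∈ A, ¬ t ≤ u j - ξ j → φ j ≤ 0 := by
    intro j hj hjt
    refine (hφ j hj).trans (max_le (sub_nonpos.2 ?_) le_rfl)
    by_contra! hju
    exact hjt (htτ.trans (h.le_residual ha hφ hcover htotal j hj hju))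
  calc ∑ g ∈ H, a g ≤ ∑ j ∈ A, φ j := htotal
    _ ≤ ∑ j ∈ A with t ≤ u j - ξ j, φ j := by
        rw [Finset.sum_filter]
        refine Finset.sum_le_sum fun j hj => ?_
        split_ifs with hjt
        exacts [le_rfl, hoff j hj hjt]
    _ ≤ coverWeight grp a H (A.filter fun j => t ≤ u j - ξ j) := hcover _ (Finset.filter_subset _ A)
    _ ≤ ∑ j ∈ A with t ≤ u j - ξ j, ξ j := h.tight t ht

theorem union [DecidableEq κ] (ha : ∀ g, 0 ≤ a g) (hH : Disjoint H H') (hAB : Disjoint A B)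
    (hsep : ∀ g ∈ H, Disjoint (grp g) B) (hA : IsLevelTight grp a u H A ξ)
    (hB : IsLevelTight grp a u H' B ξ) (hAτ : ∀ j ∈ A, u j - ξ j ≤ τ)
    (hBτ : ∀ t, 0 < t → t ≤ τ → ∑ g ∈ H', a g ≤ ∑ j ∈ B with t ≤ u j - ξ j, ξ j) :
    IsLevelTight grp a u (H ∪ H') (A ∪ B) ξ where
  nonneg j hj := (Finset.mem_union.1 hj).elim (hA.nonneg j) (hB.nonneg j)
  le j hj := (Finset.mem_union.1 hj).elim (hA.le j) (hB.le j)
  coverBounded := hA.coverBounded.union ha hH hAB hB.coverBounded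
  tight t ht := by
    rw [Finset.filter_union, Finset.sum_union (Finset.disjoint_filter_filter hAB),
      coverWeight_union hH]
    refine add_le_add (le_trans ?_ (hA.tight t ht)) ?_
    · refine coverWeight_le_coverWeight ha fun g hg j hj hjg => ⟨hg, j, ?_, hjg⟩
      exact (Finset.mem_union.1 hj).resolve_right fun hjB =>
        Finset.disjoint_left.1 (hsep g hg) hjg (Finset.mem_of_mem_filter j hjB)
    · rcases le_or_gt t τ with htτ | htτ
      · exact (coverWeight_le_sum ha).trans (hBτ t ht htτ)
      · have hA_empty : (A.filter fun j => t ≤ u j - ξ j) = ∅ :=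
          Finset.filter_eq_empty_iff.2 fun j hj => ((hAτ j hj).trans_lt htτ).not_ge
        rw [hA_empty, Finset.empty_union]
        exact hB.tight t ht

end IsLevelTight

end LevelTight

section ProximalOperator

variable {p : ℕ} {κ : Type*} [Fintype κ] {grp : κ → Finset (Fin p)} {η : κ → ℝ} {lam : ℝ}
  {u ξ w : Fin p → ℝ}

theorem proxObjective_add_sq_le
    (hsub : ∀ w', ∑ j, (u j - w j) * w' j ≤ lam * Omega grp η w')
    (heq : lam * Omega grp η w ≤ ∑ j, (u j - w j) * w j) (w' : Fin p → ℝ) :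
    proxObjective grp η lam u w + (1 / 2) * ∑ j, (w' j - w j) ^ 2 ≤
      proxObjective grp η lam u w' := by
  have hexpand : (1 / 2) * ∑ j, (u j - w' j) ^ 2 = (1 / 2) * ∑ j, (u j - w j) ^ 2 +
      (1 / 2) * ∑ j, (w' j - w j) ^ 2 + ∑ j, (u j - w j) * w j - ∑ j, (u j - w j) * w' j := by
    simp only [Finset.mul_sum, ← Finset.sum_add_distrib, ← Finset.sum_sub_distrib]
    exact Finset.sum_congr rfl fun j _ => by ring
  unfold proxObjective
  linarith [hsub w']

/-- As `λΩ` is positively homogeneous, the two inequalities say that `u - w` is a subgradient of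
it at `w`. -/
theorem isProx_of_subgradient (hsub : ∀ w', ∑ j, (u j - w j) * w' j ≤ lam * Omega grp η w')
    (heq : lam * Omega grp η w ≤ ∑ j, (u j - w j) * w j) : IsProx grp η lam u w := by
  have hgrowth := proxObjective_add_sq_le hsub heq
  have hnonneg : ∀ v : Fin p → ℝ, 0 ≤ ∑ j, (v j - w j) ^ 2 := fun v =>
    Finset.sum_nonneg fun j _ => sq_nonneg _
  refine ⟨fun w' => by linarith [hgrowth w', hnonneg w'], fun v hv => funext fun j => ?_⟩
  have hzero : ∑ j, (v j - w j) ^ 2 = 0 := by linarith [hgrowth v, hv w, hnonneg v]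
  have hj := (Finset.sum_eq_zero_iff_of_nonneg fun j _ => sq_nonneg (v j - w j)).1 hzero j
    (Finset.mem_univ j)
  exact sub_eq_zero.1 (sq_eq_zero_iff.1 hj)

theorem le_norm_restrict_iff (w : Fin p → ℝ) (A : Finset (Fin p)) {t : ℝ} (ht : 0 < t) :
    t ≤ ‖fun j : {j // j ∈ A} => w j‖ ↔
      ∃ j ∈ Finset.univ.filter (fun j => t ≤ |w j|), j ∈ A := by
  rw [← not_lt, pi_norm_lt_iff ht]
  simp [and_comm]

theorem coverWeight_level_eq (w : Fin p → ℝ) {t : ℝ} (ht : 0 < t) :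
    coverWeight grp (fun g => lam * η g) Finset.univ (Finset.univ.filter fun j => t ≤ |w j|) =
      ∑ g with t ≤ ‖fun j : {j // j ∈ grp g} => w j‖, lam * η g := by
  refine Finset.sum_congr (Finset.ext fun g => ?_) fun _ _ => rfl
  simp only [Finset.mem_filter_univ, le_norm_restrict_iff w _ ht]

theorem mul_Omega_eq_sum (w : Fin p → ℝ) :
    lam * Omega grp η w = ∑ g, lam * η g * ‖fun j : {j // j ∈ grp g} => w j‖ := by
  simp only [Omega, Finset.mul_sum, mul_assoc]

theorem IsCoverBounded.sum_mul_abs_le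
    (h : IsCoverBounded grp (fun g => lam * η g) Finset.univ Finset.univ ξ) (w : Fin p → ℝ) :
    ∑ j, ξ j * |w j| ≤ lam * Omega grp η w := by
  rw [mul_Omega_eq_sum]
  refine sum_mul_le_sum_mul_of_level_sums_le (fun j _ => abs_nonneg _) (fun g _ => norm_nonneg _)
    fun t ht => ?_
  rw [← coverWeight_level_eq w ht]
  exact h _ (Finset.subset_univ _)

theorem IsLevelTight.le_sum_mul_abs
    (h : IsLevelTight grp (fun g => lam * η g) u Finset.univ Finset.univ ξ)
    (hw : ∀ j, |w j| = u j - ξ j) : lam * Omega grp η w ≤ ∑ j, ξ j * |w j| := by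
  rw [mul_Omega_eq_sum]
  refine sum_mul_le_sum_mul_of_level_sums_le (fun g _ => norm_nonneg _) (fun j _ => abs_nonneg _)
    fun t ht => ?_
  rw [← coverWeight_level_eq w ht]
  simpa only [hw] using h.tight t ht

theorem IsLevelTight.isProx
    (h : IsLevelTight grp (fun g => lam * η g) (fun j => |u j|) Finset.univ Finset.univ ξ) :
    IsProx grp η lam u fun j => u j - (if u j < 0 then -ξ j else ξ j) := by
  have hξ : ∀ j, 0 ≤ ξ j := fun j => h.nonneg j (Finset.mem_univ j)
  have hξu : ∀ j, ξ j ≤ |u j| := fun j => h.le j (Finset.mem_univ j)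
  have habs : ∀ j, |u j - (if u j < 0 then -ξ j else ξ j)| = |u j| - ξ j := by
    intro j
    have hj := hξu j
    split_ifs with hneg
    · rw [abs_of_neg hneg] at hj ⊢
      rw [abs_of_nonpos (by linarith)]
      ring
    · rw [abs_of_nonneg (not_lt.1 hneg)] at hj ⊢
      exact abs_of_nonneg (sub_nonneg.2 hj)
  refine isProx_of_subgradient (fun w' => ?_) ?_
  · refine (Finset.sum_le_sum fun j _ => ?_).trans (h.coverBounded.sum_mul_abs_le w')
    rw [sub_sub_cancel]
    split_ifs
    · nlinarith [mul_le_mul_of_nonneg_left (neg_le_abs (w' j)) (hξ j)]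
    · exact mul_le_mul_of_nonneg_left (le_abs_self (w' j)) (hξ j)
  · refine (h.le_sum_mul_abs habs).trans_eq (Finset.sum_congr rfl fun j _ => ?_)
    rw [habs, sub_sub_cancel]
    split_ifs with hneg
    · rw [abs_of_neg hneg]
      ring
    · rw [abs_of_nonneg (not_lt.1 hneg)]

end ProximalOperator

section ProjectionStep

variable {p : ℕ} {κ : Type*} [Fintype κ] [DecidableEq κ] {η : κ → ℝ} {lam τ : ℝ}
  {u γ : Fin p → ℝ} {V : Finset (Vertex p κ)}

theorem sum_abs_soft_threshold_le
    (h : IsThreshold (varsOf V) u (lam * ∑ g ∈ grpsOf V, η g) τ) :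
    ∑ j ∈ varsOf V, |max (u j - τ) 0| ≤ lam * ∑ g ∈ grpsOf V, η g := by
  simpa only [abs_of_nonneg (le_max_right _ (0 : ℝ))] using h.sum_le

theorem IsThreshold.isProjectionStep (hu : ∀ j, 0 ≤ u j)
    (h : IsThreshold (varsOf V) u (lam * ∑ g ∈ grpsOf V, η g) τ) :
    IsProjectionStep η lam u V fun j => max (u j - τ) 0 := by
  refine ⟨sum_abs_soft_threshold_le h, fun γ' hγ' => ?_⟩
  have hnonneg : 0 ≤ ∑ j ∈ varsOf V, (1 / 2) * (γ' j - max (u j - τ) 0) ^ 2 :=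
    Finset.sum_nonneg fun j _ => by positivity
  linarith [h.sum_sq_add_sum_sq_le (fun j _ => hu j) hγ']

theorem IsProjectionStep.eq_soft_threshold (hu : ∀ j, 0 ≤ u j)
    (hτ : IsThreshold (varsOf V) u (lam * ∑ g ∈ grpsOf V, η g) τ)
    (h : IsProjectionStep η lam u V γ) : ∀ j ∈ varsOf V, γ j = max (u j - τ) 0 := by
  have hnonneg : ∀ j ∈ varsOf V, 0 ≤ (1 / 2) * (γ j - max (u j - τ) 0) ^ 2 :=
    fun j _ => by positivity
  have hmin := h.2 (fun j => max (u j - τ) 0) (sum_abs_soft_threshold_le hτ)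
  have hzero : ∑ j ∈ varsOf V, (1 / 2) * (γ j - max (u j - τ) 0) ^ 2 = 0 :=
    le_antisymm (by linarith [hτ.sum_sq_add_sum_sq_le (fun j _ => hu j) h.1])
      (Finset.sum_nonneg hnonneg)
  intro j hj
  have hj_zero := (Finset.sum_eq_zero_iff_of_nonneg hnonneg).1 hzero j hj
  exact sub_eq_zero.1 (sq_eq_zero_iff.1 (by linarith))

theorem exists_isProjectionStep (hu : ∀ j, 0 ≤ u j) (V : Finset (Vertex p κ))
    (hR : 0 ≤ lam * ∑ g ∈ grpsOf V, η g) : ∃ γ, IsProjectionStep η lam u V γ :=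
  (exists_isThreshold (varsOf V) u hR).elim fun _ hτ => ⟨_, hτ.isProjectionStep hu⟩

theorem IsProjectionStep.exists_threshold (hu : ∀ j, 0 ≤ u j)
    (h : IsProjectionStep η lam u V γ) :
    ∃ τ, IsThreshold (varsOf V) u (lam * ∑ g ∈ grpsOf V, η g) τ ∧
      ∀ j ∈ varsOf V, γ j = max (u j - τ) 0 := by
  have hR : 0 ≤ lam * ∑ g ∈ grpsOf V, η g :=
    (Finset.sum_nonneg fun j _ => abs_nonneg (γ j)).trans h.1
  obtain ⟨τ, hτ⟩ := exists_isThreshold (varsOf V) u hR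
  exact ⟨τ, hτ, h.eq_soft_threshold hu hτ⟩

end ProjectionStep

section VertexSets

variable {p : ℕ} {κ : Type*} {V : Finset (Vertex p κ)} {S : Finset (Node p κ)}

/-- The vertices of `V` as nodes of the network, that is, without the source and the sink. -/
def vertexNodes (V : Finset (Vertex p κ)) : Finset (Node p κ) :=
  V.map Function.Embedding.inr

theorem inr_mem_vertexNodes {v : Vertex p κ} : Sum.inr v ∈ vertexNodes V ↔ v ∈ V :=
  Finset.mem_map' _

theorem source_notMem_vertexNodes : source ∉ vertexNodes V := by simp [vertexNodes]

theorem sink_notMem_vertexNodes : sink ∉ vertexNodes V := by simp [vertexNodes]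

theorem mem_vertexNodes_univ [Fintype κ] {a : Node p κ} (hs : a ≠ source) (ht : a ≠ sink) :
    a ∈ vertexNodes (Finset.univ : Finset (Vertex p κ)) := by
  rcases a with (_ | _) | v
  exacts [absurd rfl hs, absurd rfl ht, inr_mem_vertexNodes.2 (Finset.mem_univ v)]

variable [DecidableEq κ]

theorem mem_varsOf {j : Fin p} : j ∈ varsOf V ↔ Sum.inl j ∈ V := by
  simp [varsOf]

theorem mem_vertexNodes_plusPart {a : Node p κ} :
    a ∈ vertexNodes (plusPart V S) ↔ a ∈ vertexNodes V ∧ a ∈ S := by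
  rcases a with b | v <;> simp [vertexNodes, plusPart]

theorem mem_vertexNodes_minusPart {a : Node p κ} :
    a ∈ vertexNodes (minusPart V S) ↔ a ∈ vertexNodes V ∧ a ∉ S := by
  rcases a with b | v <;> simp [vertexNodes, minusPart]

theorem varsOf_plusPart_union_minusPart :
    varsOf (plusPart V S) ∪ varsOf (minusPart V S) = varsOf V := by
  ext j
  simp only [Finset.mem_union, mem_varsOf, plusPart, minusPart, Finset.mem_filter]
  tauto

theorem disjoint_varsOf_plusPart_minusPart :
    Disjoint (varsOf (plusPart V S)) (varsOf (minusPart V S)) := by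
  simp only [Finset.disjoint_left, mem_varsOf, plusPart, minusPart, Finset.mem_filter]
  tauto

variable [Fintype κ]

theorem mem_grpsOf {g : κ} : g ∈ grpsOf V ↔ Sum.inr g ∈ V := by
  simp [grpsOf]

theorem grpsOf_plusPart_union_minusPart :
    grpsOf (plusPart V S) ∪ grpsOf (minusPart V S) = grpsOf V := by
  ext g
  simp only [Finset.mem_union, mem_grpsOf, plusPart, minusPart, Finset.mem_filter]
  tauto

theorem disjoint_grpsOf_plusPart_minusPart :
    Disjoint (grpsOf (plusPart V S)) (grpsOf (minusPart V S)) := by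
  simp only [Finset.disjoint_left, mem_grpsOf, plusPart, minusPart, Finset.mem_filter]
  tauto

theorem sum_vertexNodes {M : Type*} [AddCommMonoid M] (V : Finset (Vertex p κ))
    (F : Node p κ → M) :
    ∑ v ∈ vertexNodes V, F v = ∑ j ∈ varsOf V, F (varNode j) + ∑ g ∈ grpsOf V, F (grpNode g) := by
  have hV : (varsOf V).disjSum (grpsOf V) = V := by
    ext (j | g) <;> simp [mem_varsOf, mem_grpsOf]
  conv_lhs => rw [vertexNodes, Finset.sum_map, ← hV]
  exact Finset.sum_disjSum _ _ _

end VertexSets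

section GroupNetworks

variable {p : ℕ} {κ : Type*} {grp : κ → Finset (Fin p)} {η : κ → ℝ} {lam : ℝ}
  {c : Node p κ → Node p κ → ℝ≥0∞}

/-- What the algorithm needs of a graph equivalent to the canonical one. Paths are replaced by
reachability, their uniqueness is dropped, and the capacities of the arcs `(j,t)`, which the
algorithm overwrites, are arbitrary. -/
structure IsGroupNetwork (grp : κ → Finset (Fin p)) (η : κ → ℝ) (lam : ℝ)
    (c : Node p κ → Node p κ → ℝ≥0∞) : Prop where
  into_source : ∀ v, c v source = 0
  out_of_sink : ∀ v, c sink v = 0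
  out_of_source : ∀ v, c source v = canonicalGraph grp η lam source v
  grp_sink : ∀ g, c (grpNode g) sink = 0
  reachable_of_mem : ∀ g, ∀ j ∈ grp g,
    Relation.ReflTransGen (fun a b => c a b = ⊤) (grpNode g) (varNode j)
  mem_of_reachable : ∀ g j,
    Relation.ReflTransGen (fun a b => 0 < c a b) (grpNode g) (varNode j) → j ∈ grp g

theorem mem_of_canonicalGraph_reachable {g : κ} {j : Fin p}
    (h : Relation.ReflTransGen (fun a b => 0 < canonicalGraph grp η lam a b)
      (grpNode g) (varNode j)) : j ∈ grp g := by
  obtain hgj | ⟨a, hga, haj⟩ := h.cases_head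
  · simp at hgj
  have ha : ∀ b : Node p κ,
      Relation.ReflTransGen (fun a b => 0 < canonicalGraph grp η lam a b) a b →
        b = a ∨ b = sink := by
    intro b hab
    rcases a with (_ | _) | (i | _) <;> simp [canonicalGraph] at hga
    induction hab with
    | refl => exact .inl rfl
    | @tail b d _ hbd ih =>
      rcases ih with rfl | rfl <;> rcases d with (_ | _) | (_ | _) <;>
        simp [canonicalGraph] at hbd ⊢
  rcases ha _ haj with rfl | hsink
  · by_contra hj
    simp [canonicalGraph, hj] at hga
  · simp at hsink

theorem isGroupNetwork_canonicalGraph (grp : κ → Finset (Fin p)) (η : κ → ℝ) (lam : ℝ) :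
    IsGroupNetwork grp η lam (canonicalGraph grp η lam) where
  into_source v := by rcases v with (_ | _) | (_ | _) <;> rfl
  out_of_sink v := by rcases v with (_ | _) | (_ | _) <;> rfl
  out_of_source _ := rfl
  grp_sink _ := rfl
  reachable_of_mem _ _ hj := .single (if_pos hj)
  mem_of_reachable _ _ := mem_of_canonicalGraph_reachable

theorem IsEquivalentGraph.isGroupNetwork (hc : IsEquivalentGraph grp η lam c) :
    IsGroupNetwork grp η lam c where
  into_source := hc.into_source
  out_of_sink := hc.out_of_sink
  out_of_source := hc.out_of_source
  grp_sink _ := hc.into_sink _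
  reachable_of_mem g j hj := by
    obtain ⟨l, ⟨⟨_, hhead, hlast, _⟩, hchain⟩, _⟩ := hc.path_of_mem g j hj
    exact reflTransGen_of_isChain hhead hlast hchain
  mem_of_reachable g j h := by
    obtain ⟨l, hl⟩ := exists_nodup_isChain h
    exact hc.mem_of_path g j l hl

variable {γ : Fin p → ℝ} {V : Finset (Vertex p κ)}

theorem callGraph_le_setSinkCapacity (c : Node p κ → Node p κ → ℝ≥0∞) (V : Finset (Vertex p κ))
    (γ : Fin p → ℝ) (a b : Node p κ) : callGraph c V γ a b ≤ setSinkCapacity c γ a b := by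
  rw [callGraph]
  split_ifs
  exacts [le_rfl, zero_le]

theorem callGraph_of_mem {a b : Node p κ}
    (ha : a ∈ vertexNodes V) (hb : b ∈ vertexNodes V) : callGraph c V γ a b = c a b := by
  obtain ⟨v, hv, rfl⟩ := Finset.mem_map.1 ha
  obtain ⟨w, hw, rfl⟩ := Finset.mem_map.1 hb
  refine (if_pos ⟨hv, hw⟩).trans ?_
  rcases v with v | v <;> rfl

theorem callGraph_varNode_sink {j : Fin p}
    (hj : Sum.inl j ∈ V) : callGraph c V γ (varNode j) sink = ENNReal.ofReal (γ j) :=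
  if_pos ⟨hj, trivial⟩

namespace IsGroupNetwork

theorem callGraph_source_le (hc : IsGroupNetwork grp η lam c) (V : Finset (Vertex p κ))
    (γ : Fin p → ℝ) (a : Node p κ) :
    callGraph c V γ source a ≤ canonicalGraph grp η lam source a :=
  (callGraph_le_setSinkCapacity c V γ source a).trans_eq (hc.out_of_source a)

theorem callGraph_source_grp (hc : IsGroupNetwork grp η lam c) {g : κ} (hg : Sum.inr g ∈ V) :
    callGraph c V γ source (grpNode g) = ENNReal.ofReal (lam * η g) :=
  (if_pos ⟨trivial, hg⟩).trans (hc.out_of_source _)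

theorem callGraph_grp_sink (hc : IsGroupNetwork grp η lam c) (V : Finset (Vertex p κ))
    (γ : Fin p → ℝ) (g : κ) : callGraph c V γ (grpNode g) sink = 0 :=
  le_zero_iff.1 ((callGraph_le_setSinkCapacity c V γ _ _).trans_eq (hc.grp_sink g))

theorem callGraph_eq_zero_of_notMem_left (hc : IsGroupNetwork grp η lam c) {a : Node p κ}
    (ha : a ∉ vertexNodes V) (has : a ≠ source) (b : Node p κ) : callGraph c V γ a b = 0 := by
  rcases a with (_ | _) | v
  · exact absurd rfl has
  · exact le_zero_iff.1 ((callGraph_le_setSinkCapacity c V γ _ _).trans_eq (hc.out_of_sink b))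
  · exact if_neg fun h => ha (inr_mem_vertexNodes.2 h.1)

theorem callGraph_eq_zero_of_notMem_right (hc : IsGroupNetwork grp η lam c) {b : Node p κ}
    (hb : b ∉ vertexNodes V) (hbt : b ≠ sink) (a : Node p κ) : callGraph c V γ a b = 0 := by
  rcases b with (_ | _) | v
  · refine le_zero_iff.1 ((callGraph_le_setSinkCapacity c V γ _ _).trans_eq ?_)
    rcases a with _ | (_ | _) <;> exact hc.into_source _
  · exact absurd rfl hbt
  · exact if_neg fun h => hb (inr_mem_vertexNodes.2 h.2)

end IsGroupNetwork

end GroupNetworks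

section CallFlows

variable {p : ℕ} {κ : Type*} {grp : κ → Finset (Fin p)} {η : κ → ℝ} {lam : ℝ}
  {c : Node p κ → Node p κ → ℝ≥0∞} {γ : Fin p → ℝ} {V U : Finset (Vertex p κ)}
  {S : Finset (Node p κ)} {f : Node p κ → Node p κ → ℝ}

theorem IsFlow.varNode_sink_le [Fintype κ] [DecidableEq κ]
    (hf : IsFlow (callGraph c V γ) source sink f) {j : Fin p} (hj : j ∈ varsOf V)
    (hγ : 0 ≤ γ j) : f (varNode j) sink ≤ γ j := by
  rw [← ENNReal.ofReal_le_ofReal_iff hγ, ← callGraph_varNode_sink (c := c) (mem_varsOf.1 hj)]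
  exact hf.le_cap _ _

theorem Saturates.varNode_sink_eq [DecidableEq κ] (hf : Saturates (callGraph c V γ) f S)
    (hf_nonneg : ∀ a b, 0 ≤ f a b) (ht : sink ∉ S) {j : Fin p}
    (hj : j ∈ varsOf (plusPart V S)) (hγ : 0 ≤ γ j) : f (varNode j) sink = γ j := by
  obtain ⟨hjV, hjS⟩ := mem_vertexNodes_plusPart.1 (inr_mem_vertexNodes.2 (mem_varsOf.1 hj))
  have hsat := hf.ofReal_eq _ hjS _ ht
  rw [callGraph_varNode_sink (inr_mem_vertexNodes.1 hjV)] at hsat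
  exact (ENNReal.ofReal_eq_ofReal_iff (hf_nonneg _ _) hγ).1 hsat

/-- Inside `V`, every group reaches its variables through arcs of infinite capacity. -/
def InfinitelyConnected (grp : κ → Finset (Fin p)) (c : Node p κ → Node p κ → ℝ≥0∞)
    (V : Finset (Vertex p κ)) : Prop :=
  ∀ g j, Sum.inr g ∈ V → Sum.inl j ∈ V → j ∈ grp g →
    Relation.ReflTransGen (fun a b => c a b = ⊤ ∧ a ∈ vertexNodes V ∧ b ∈ vertexNodes V)
      (grpNode g) (varNode j)

open Classical in
/-- The vertices of `U` from which a variable of `J` can be reached. -/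
noncomputable def upstream (c : Node p κ → Node p κ → ℝ≥0∞) (U : Finset (Vertex p κ))
    (J : Finset (Fin p)) : Finset (Vertex p κ) :=
  U.filter fun v => ∃ j ∈ J,
    Relation.ReflTransGen (fun a b => 0 < c a b) (Sum.inr v) (varNode j)

theorem mem_upstream {J : Finset (Fin p)} {v : Vertex p κ} :
    v ∈ upstream c U J ↔ v ∈ U ∧
      ∃ j ∈ J, Relation.ReflTransGen (fun a b => 0 < c a b) (Sum.inr v) (varNode j) := by
  simp only [upstream, Finset.mem_filter]

namespace IsGroupNetwork

theorem infinitelyConnected_univ [Fintype κ] (hc : IsGroupNetwork grp η lam c) :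
    InfinitelyConnected grp c Finset.univ := by
  intro g j _ _ hj
  have hsource : ∀ a b, c a b = ⊤ → a ≠ source → b ≠ source := by
    rintro a _ hab - rfl
    simp [hc.into_source] at hab
  have hsink : ∀ a b, c a b = ⊤ ∧ a ≠ source ∧ b ≠ source → b ≠ sink → a ≠ sink := by
    rintro _ b ⟨hab, -⟩ - rfl
    simp [hc.out_of_sink] at hab
  refine Relation.ReflTransGen.mono ?_ _ _ (reflTransGen_restrict_of_forall_left hsink
    (reflTransGen_restrict_of_forall_right hsource (hc.reachable_of_mem g j hj) (by simp))
    (by simp))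
  rintro a b ⟨⟨hab, has, hbs⟩, hat, hbt⟩
  exact ⟨hab, mem_vertexNodes_univ has hat, mem_vertexNodes_univ hbs hbt⟩

variable [Fintype κ]

theorem flow_eq_zero_of_mem_upstream (hc : IsGroupNetwork grp η lam c)
    (hf : IsFlow (callGraph c V γ) source sink f) (hUV : U ⊆ V)
    (hU : ∀ a ∈ vertexNodes V, a ∉ vertexNodes U → ∀ b ∈ vertexNodes U, f a b = 0)
    {J : Finset (Fin p)} {a b : Node p κ} (ha : a ∉ vertexNodes (upstream c U J))
    (hb : b ∈ vertexNodes (upstream c U J)) (has : a ≠ source) : f a b = 0 := by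
  obtain ⟨w, hw, rfl⟩ := Finset.mem_map.1 hb
  obtain ⟨hwU, j, hj, hwj⟩ := mem_upstream.1 hw
  by_cases haV : a ∈ vertexNodes V
  · by_cases haU : a ∈ vertexNodes U
    · refine hf.eq_zero_of_capacity_eq_zero ?_
      refine (callGraph_of_mem haV (inr_mem_vertexNodes.2 (hUV hwU))).trans ?_
      by_contra hne
      obtain ⟨v, hvU, rfl⟩ := Finset.mem_map.1 haU
      exact ha (inr_mem_vertexNodes.2
        (mem_upstream.2 ⟨hvU, j, hj, .head (pos_iff_ne_zero.2 hne) hwj⟩))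
    · exact hU a haV haU _ (inr_mem_vertexNodes.2 hwU)
  · exact hf.eq_zero_of_capacity_eq_zero (hc.callGraph_eq_zero_of_notMem_left haV has _)

variable [DecidableEq κ]

theorem cutCapacity_source_ne_top (hc : IsGroupNetwork grp η lam c) (V : Finset (Vertex p κ))
    (γ : Fin p → ℝ) : cutCapacity (callGraph c V γ) {source} ≠ ⊤ := by
  rw [cutCapacity, Finset.sum_singleton]
  refine ENNReal.sum_ne_top.2 fun a _ => ne_top_of_le_ne_top ?_ (hc.callGraph_source_le V γ a)
  rcases a with (_ | _) | (_ | _) <;> simp [canonicalGraph]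

/-- An arc of infinite capacity cannot cross a minimum cut, as some cut has finite capacity. -/
theorem mem_of_eq_top (hc : IsGroupNetwork grp η lam c)
    (hS : IsMinCut (callGraph c V γ) source sink S) {a b : Node p κ}
    (hab : c a b = ⊤ ∧ a ∈ vertexNodes V ∧ b ∈ vertexNodes V) (haS : a ∈ S) : b ∈ S := by
  by_contra hbS
  have hfin : cutCapacity (callGraph c V γ) S ≠ ⊤ :=
    ne_top_of_le_ne_top (hc.cutCapacity_source_ne_top V γ) (hS.2.2 {source} (by simp) (by simp))
  refine ENNReal.sum_ne_top.1 (ENNReal.sum_ne_top.1 hfin a haS) b (Finset.mem_compl.2 hbS) ?_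
  rw [callGraph_of_mem hab.2.1 hab.2.2, hab.1]

theorem infinitelyConnected_plusPart (hc : IsGroupNetwork grp η lam c)
    (hS : IsMinCut (callGraph c V γ) source sink S) (hV : InfinitelyConnected grp c V) :
    InfinitelyConnected grp c (plusPart V S) := by
  intro g j hg hj hjg
  rw [← inr_mem_vertexNodes, mem_vertexNodes_plusPart, inr_mem_vertexNodes] at hg hj
  simp only [mem_vertexNodes_plusPart]
  refine Relation.ReflTransGen.mono ?_ _ _ (reflTransGen_restrict_of_forall_right
    (fun a b hab => hc.mem_of_eq_top hS hab) (hV g j hg.1 hj.1 hjg) hg.2)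
  rintro a b ⟨⟨hab, haV, hbV⟩, haS, hbS⟩
  exact ⟨hab, ⟨haV, haS⟩, hbV, hbS⟩

theorem infinitelyConnected_minusPart (hc : IsGroupNetwork grp η lam c)
    (hS : IsMinCut (callGraph c V γ) source sink S) (hV : InfinitelyConnected grp c V) :
    InfinitelyConnected grp c (minusPart V S) := by
  intro g j hg hj hjg
  rw [← inr_mem_vertexNodes, mem_vertexNodes_minusPart, inr_mem_vertexNodes] at hg hj
  simp only [mem_vertexNodes_minusPart]
  refine Relation.ReflTransGen.mono ?_ _ _ (reflTransGen_restrict_of_forall_left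
    (fun a b hab => mt (hc.mem_of_eq_top hS hab)) (hV g j hg.1 hj.1 hjg) hj.2)
  rintro a b ⟨⟨hab, haV, hbV⟩, haS, hbS⟩
  exact ⟨hab, ⟨haV, haS⟩, hbV, hbS⟩

theorem disjoint_varsOf_minusPart (hc : IsGroupNetwork grp η lam c)
    (hS : IsMinCut (callGraph c V γ) source sink S) (hV : InfinitelyConnected grp c V) {g : κ}
    (hg : g ∈ grpsOf (plusPart V S)) : Disjoint (grp g) (varsOf (minusPart V S)) := by
  refine Finset.disjoint_left.2 fun j hjg hj => ?_
  rw [mem_grpsOf, ← inr_mem_vertexNodes, mem_vertexNodes_plusPart, inr_mem_vertexNodes] at hg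
  rw [mem_varsOf, ← inr_mem_vertexNodes, mem_vertexNodes_minusPart, inr_mem_vertexNodes] at hj
  have hreach := hV g j hg.1 hj.1 hjg
  have hclosed : ∀ b, Relation.ReflTransGen
      (fun a b => c a b = ⊤ ∧ a ∈ vertexNodes V ∧ b ∈ vertexNodes V) (grpNode g) b → b ∈ S := by
    intro b hb
    induction hb with
    | refl => exact hg.2
    | tail _ hab ih => exact hc.mem_of_eq_top hS hab ih
  exact hj.2 (hclosed _ hreach)

theorem sum_flow_source_le (hc : IsGroupNetwork grp η lam c) (ha : ∀ g, 0 ≤ lam * η g)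
    (hf : IsFlow (callGraph c V γ) source sink f) (W : Finset (Vertex p κ)) :
    ∑ v ∈ vertexNodes W, f source v ≤ ∑ g ∈ grpsOf W, lam * η g := by
  have hle : ∀ a, ENNReal.ofReal (f source a) ≤ canonicalGraph grp η lam source a := fun a =>
    (hf.le_cap source a).trans (hc.callGraph_source_le V γ a)
  rw [sum_vertexNodes]
  refine add_le_of_nonpos_of_le (Finset.sum_nonpos fun j _ => ?_) (Finset.sum_le_sum fun g _ => ?_)
  · exact ENNReal.ofReal_eq_zero.1 (le_zero_iff.1 (hle (varNode j)))
  · exact (ENNReal.ofReal_le_ofReal_iff (ha g)).1 (hle (grpNode g))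

/-- The flow through `J` enters the upstream part of `U` from the source alone, hence through
groups that meet `J`. -/
theorem sum_flow_le_coverWeight (hc : IsGroupNetwork grp η lam c) (ha : ∀ g, 0 ≤ lam * η g)
    (hf : IsFlow (callGraph c V γ) source sink f) (hUV : U ⊆ V)
    (hU : ∀ a ∈ vertexNodes V, a ∉ vertexNodes U → ∀ b ∈ vertexNodes U, f a b = 0) :
    IsCoverBounded grp (fun g => lam * η g) (grpsOf U) (varsOf U)
      fun j => f (varNode j) sink := by
  intro J hJ
  have hJ_upstream : J ⊆ varsOf (upstream c U J) := fun j hj =>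
    mem_varsOf.2 (mem_upstream.2 ⟨mem_varsOf.1 (hJ hj), j, hj, .refl⟩)
  calc ∑ j ∈ J, f (varNode j) sink
      ≤ ∑ j ∈ varsOf (upstream c U J), f (varNode j) sink :=
        Finset.sum_le_sum_of_subset_of_nonneg hJ_upstream fun _ _ _ => hf.nonneg _ _
    _ ≤ ∑ v ∈ vertexNodes (upstream c U J), f v sink := by
        rw [sum_vertexNodes]
        exact le_add_of_nonneg_right (Finset.sum_nonneg fun _ _ => hf.nonneg _ _)
    _ ≤ ∑ v ∈ vertexNodes (upstream c U J), f source v :=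
        hf.sum_sink_le_sum_source source_notMem_vertexNodes sink_notMem_vertexNodes
          fun _ h _ h' => hc.flow_eq_zero_of_mem_upstream hf hUV hU h h'
    _ ≤ ∑ g ∈ grpsOf (upstream c U J), lam * η g := hc.sum_flow_source_le ha hf _
    _ ≤ coverWeight grp (fun g => lam * η g) (grpsOf U) J := by
        refine sum_le_coverWeight ha fun g hg => ?_
        obtain ⟨hgU, j, hj, hgj⟩ := mem_upstream.1 (mem_grpsOf.1 hg)
        exact ⟨mem_grpsOf.2 hgU, j, hj, hc.mem_of_reachable g j hgj⟩

theorem sum_le_sum_flow_minusPart (hc : IsGroupNetwork grp η lam c) (ha : ∀ g, 0 ≤ lam * η g)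
    (hf : IsFlow (callGraph c V γ) source sink f) (hsat : Saturates (callGraph c V γ) f S)
    (hs : source ∈ S) :
    ∑ g ∈ grpsOf (minusPart V S), lam * η g ≤
      ∑ j ∈ varsOf (minusPart V S), f (varNode j) sink := by
  have hfull : ∀ g ∈ grpsOf (minusPart V S), lam * η g = f source (grpNode g) := by
    intro g hg
    rw [mem_grpsOf, ← inr_mem_vertexNodes, mem_vertexNodes_minusPart, inr_mem_vertexNodes] at hg
    have hg_sat := hsat.ofReal_eq _ hs _ hg.2
    rw [hc.callGraph_source_grp hg.1] at hg_sat
    exact ((ENNReal.ofReal_eq_ofReal_iff (hf.nonneg _ _) (ha g)).1 hg_sat).symm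
  have hclosed : ∀ a ∈ vertexNodes (minusPart V S), ∀ b ∉ vertexNodes (minusPart V S),
      b ≠ sink → f a b = 0 := by
    intro a haV b hb hbt
    by_cases hbV : b ∈ vertexNodes V
    · have hbS : b ∈ S := not_not.1 fun h => hb (mem_vertexNodes_minusPart.2 ⟨hbV, h⟩)
      exact hsat.eq_zero a (mem_vertexNodes_minusPart.1 haV).2 b hbS
    · exact hf.eq_zero_of_capacity_eq_zero (hc.callGraph_eq_zero_of_notMem_right hbV hbt a)
  calc ∑ g ∈ grpsOf (minusPart V S), lam * η g
      = ∑ g ∈ grpsOf (minusPart V S), f source (grpNode g) := Finset.sum_congr rfl hfull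
    _ ≤ ∑ v ∈ vertexNodes (minusPart V S), f source v := by
        rw [sum_vertexNodes]
        exact le_add_of_nonneg_left (Finset.sum_nonneg fun _ _ => hf.nonneg _ _)
    _ ≤ ∑ v ∈ vertexNodes (minusPart V S), f v sink :=
        hf.sum_source_le_sum_sink source_notMem_vertexNodes sink_notMem_vertexNodes hclosed
    _ = ∑ j ∈ varsOf (minusPart V S), f (varNode j) sink := by
        rw [sum_vertexNodes, Finset.sum_eq_zero fun g _ =>
          hf.eq_zero_of_capacity_eq_zero (hc.callGraph_grp_sink V γ g), add_zero]

end IsGroupNetwork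

end CallFlows

section Algorithm

variable {p : ℕ} {κ : Type*} [Fintype κ] [DecidableEq κ] {grp : κ → Finset (Fin p)} {η : κ → ℝ}
  {lam τ : ℝ} {u γ ξ : Fin p → ℝ} {c : Node p κ → Node p κ → ℝ≥0∞} {V W : Finset (Vertex p κ)}
  {S : Finset (Node p κ)} {f : Node p κ → Node p κ → ℝ}

namespace IsGroupNetwork

theorem isLevelTight_of_eq (hc : IsGroupNetwork grp η lam c) (ha : ∀ g, 0 ≤ lam * η g)
    (hu : ∀ j, 0 ≤ u j) (step : IsFlowStep η lam c u V γ f)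
    (heq : ∀ j ∈ varsOf V, f (varNode j) sink = γ j) :
    IsLevelTight grp (fun g => lam * η g) u (grpsOf V) (varsOf V) fun j => f (varNode j) sink := by
  obtain ⟨τ, hτ, hγ⟩ := step.1.exists_threshold hu
  have hsoft : ∀ j ∈ varsOf V, f (varNode j) sink = max (u j - τ) 0 := fun j hj =>
    (heq j hj).trans (hγ j hj)
  rw [Finset.mul_sum] at hτ
  have hcover := hc.sum_flow_le_coverWeight ha step.2.1 subset_rfl fun a haV haV' => absurd haV haV'
  exact (IsLevelTight.of_soft_threshold ha (fun j _ => hu j) hτ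
    (hcover.congr fun j hj => (hsoft j hj).symm)).congr hsoft

theorem residual_plusPart_le (hc : IsGroupNetwork grp η lam c) (ha : ∀ g, 0 ≤ lam * η g)
    (hf : IsMaxFlow (callGraph c V γ) source sink f) (hS : IsMinCut (callGraph c V γ) source sink S)
    (hτ : 0 ≤ τ) (hγ : ∀ j ∈ varsOf V, γ j = max (u j - τ) 0)
    (h : IsLevelTight grp (fun g => lam * η g) u
      (grpsOf (plusPart V S)) (varsOf (plusPart V S)) ξ) :
    ∀ j ∈ varsOf (plusPart V S), u j - ξ j ≤ τ := by
  have hsat := hf.saturates_of_isMinCut hS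
  refine h.residual_le hτ (φ := fun j => f (varNode j) sink) (fun j hj => ?_)
    (hc.sum_flow_le_coverWeight ha hf.1 (Finset.filter_subset _ _) fun a haV ha' b hb => ?_)
  · have hjV : j ∈ varsOf V := mem_varsOf.2 (Finset.mem_of_mem_filter _ (mem_varsOf.1 hj))
    rw [hsat.varNode_sink_eq hf.1.nonneg hS.2.1 hj (hγ j hjV ▸ le_max_right _ _), hγ j hjV]
    exact le_max_left _ _
  · exact hsat.eq_zero a (fun haS => ha' (mem_vertexNodes_plusPart.2 ⟨haV, haS⟩)) b
      (mem_vertexNodes_plusPart.1 hb).2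

theorem isCoverBounded_minusPart (hc : IsGroupNetwork grp η lam c) (ha : ∀ g, 0 ≤ lam * η g)
    (hV : InfinitelyConnected grp c V) (hf : IsFlow (callGraph c V γ) source sink f)
    (hS : IsMinCut (callGraph c V γ) source sink S) :
    IsCoverBounded grp (fun g => lam * η g) (grpsOf (minusPart V S)) (varsOf (minusPart V S))
      fun j => f (varNode j) sink := by
  intro J hJ
  have hJV : J ⊆ varsOf V := fun j hj =>
    mem_varsOf.2 (Finset.mem_of_mem_filter _ (mem_varsOf.1 (hJ hj)))
  refine (hc.sum_flow_le_coverWeight ha hf subset_rfl (fun a haV haV' => absurd haV haV') J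
    hJV).trans (coverWeight_le_coverWeight ha fun g hg j hj hjg => ⟨?_, j, hj, hjg⟩)
  rw [← grpsOf_plusPart_union_minusPart (S := S)] at hg
  exact (Finset.mem_union.1 hg).resolve_left fun hg_plus =>
    Finset.disjoint_left.1 (hc.disjoint_varsOf_minusPart hS hV hg_plus) hjg (hJ hj)

theorem isLevelTight_split (hc : IsGroupNetwork grp η lam c) (ha : ∀ g, 0 ≤ lam * η g)
    (hu : ∀ j, 0 ≤ u j) (hV : InfinitelyConnected grp c V) (step : IsFlowStep η lam c u V γ f)
    (hS : IsMinCut (callGraph c V γ) source sink S)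
    (hplus : IsLevelTight grp (fun g => lam * η g) u
      (grpsOf (plusPart V S)) (varsOf (plusPart V S)) ξ)
    (hminus : IsLevelTight grp (fun g => lam * η g) u
      (grpsOf (minusPart V S)) (varsOf (minusPart V S)) ξ) :
    IsLevelTight grp (fun g => lam * η g) u (grpsOf V) (varsOf V) ξ := by
  obtain ⟨hproj, hf⟩ := step
  obtain ⟨τ, hτ, hγ⟩ := hproj.exists_threshold hu
  have hflow_le : ∀ j ∈ varsOf (minusPart V S), f (varNode j) sink ≤ max (u j - τ) 0 := by
    intro j hj
    have hjV : j ∈ varsOf V := mem_varsOf.2 (Finset.mem_of_mem_filter _ (mem_varsOf.1 hj))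
    rw [← hγ j hjV]
    exact hf.1.varNode_sink_le hjV (hγ j hjV ▸ le_max_right _ _)
  have htotal := hc.sum_le_sum_flow_minusPart ha hf.1 (hf.saturates_of_isMinCut hS) hS.1
  rw [← grpsOf_plusPart_union_minusPart (S := S), ← varsOf_plusPart_union_minusPart (S := S)]
  exact hplus.union ha disjoint_grpsOf_plusPart_minusPart disjoint_varsOf_plusPart_minusPart
    (fun g hg => hc.disjoint_varsOf_minusPart hS hV hg) hminus
    (hc.residual_plusPart_le ha hf hS hτ.nonneg hγ hplus)
    fun t ht htτ => hminus.sum_le_sum_level ha hflow_le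
      (hc.isCoverBounded_minusPart ha hV hf.1 hS) htotal ht htτ

theorem isLevelTight_of_computeFlow (hc : IsGroupNetwork grp η lam c) (ha : ∀ g, 0 ≤ lam * η g)
    (hu : ∀ j, 0 ≤ u j) (hV : InfinitelyConnected grp c V) (h : ComputeFlow η lam c u V ξ) :
    IsLevelTight grp (fun g => lam * η g) u (grpsOf V) (varsOf V) ξ := by
  induction h with
  | done V γ f step eq => exact hc.isLevelTight_of_eq ha hu step eq
  | split V γ f S ξp ξm step _ cut _ _ ih_plus ih_minus =>
    exact hc.isLevelTight_split ha hu hV step cut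
      ((ih_plus (hc.infinitelyConnected_plusPart cut hV)).congr fun j hj => if_pos hj)
      ((ih_minus (hc.infinitelyConnected_minusPart cut hV)).congr fun j hj =>
        if_neg fun hj' => Finset.disjoint_left.1 disjoint_varsOf_plusPart_minusPart hj' hj)

theorem ssubset_of_recursiveCall (hc : IsGroupNetwork grp η lam c) (ha : ∀ g, 0 ≤ lam * η g)
    (hu : ∀ j, 0 ≤ u j) (h : RecursiveCall η lam c u W V) : W ⊂ V := by
  obtain ⟨γ, f, S, ⟨hproj, hf⟩, ⟨j, hj, hne⟩, hS, hW⟩ := h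
  have hsat := hf.saturates_of_isMinCut hS
  obtain ⟨τ, hτ, hγ⟩ := hproj.exists_threshold hu
  have hγ_nonneg : ∀ j ∈ varsOf V, 0 ≤ γ j := fun j hj => hγ j hj ▸ le_max_right _ _
  have hsum_le : ∑ j ∈ varsOf V, γ j ≤ lam * ∑ g ∈ grpsOf V, η g :=
    (Finset.sum_congr rfl hγ).trans_le hτ.sum_le
  rcases hW with rfl | rfl <;>
    refine Finset.ssubset_iff_subset_ne.2 ⟨Finset.filter_subset _ _, fun heq => hne ?_⟩
  · exact hsat.varNode_sink_eq hf.1.nonneg hS.2.1 (heq.symm ▸ hj) (hγ_nonneg j hj)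
  · have htotal := hc.sum_le_sum_flow_minusPart ha hf.1 hsat hS.1
    rw [heq, ← Finset.mul_sum] at htotal
    have hle : ∀ j ∈ varsOf V, f (varNode j) sink ≤ γ j := fun j hj =>
      hf.1.varNode_sink_le hj (hγ_nonneg j hj)
    exact (Finset.sum_eq_sum_iff_of_le hle).1
      (le_antisymm (Finset.sum_le_sum hle) (hsum_le.trans htotal)) j hj

theorem acc_recursiveCall (hc : IsGroupNetwork grp η lam c) (ha : ∀ g, 0 ≤ lam * η g)
    (hu : ∀ j, 0 ≤ u j) (V : Finset (Vertex p κ)) : Acc (RecursiveCall η lam c u) V :=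
  Subrelation.accessible (hc.ssubset_of_recursiveCall ha hu) (wellFounded_lt.apply V)

theorem exists_computeFlow (hc : IsGroupNetwork grp η lam c) (ha : ∀ g, 0 ≤ lam * η g)
    (hu : ∀ j, 0 ≤ u j) (V : Finset (Vertex p κ)) : ∃ ξ, ComputeFlow η lam c u V ξ := by
  induction hc.acc_recursiveCall ha hu V with
  | intro V _ ih =>
    have hR : 0 ≤ lam * ∑ g ∈ grpsOf V, η g := by
      rw [Finset.mul_sum]
      exact Finset.sum_nonneg fun g _ => ha g
    obtain ⟨γ, hγ⟩ := exists_isProjectionStep hu V hR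
    obtain ⟨f, hf⟩ := exists_isMaxFlow (s := source) (t := sink)
      (Finset.mem_singleton_self source) (by simp) (hc.cutCapacity_source_ne_top V γ)
    by_cases! heq : ∀ j ∈ varsOf V, f (varNode j) sink = γ j
    · exact ⟨_, .done V γ f ⟨hγ, hf⟩ heq⟩
    · obtain ⟨S, hS⟩ := exists_isMinCut (callGraph c V γ) (s := source) (t := sink) (by simp)
      obtain ⟨ξp, hp⟩ := ih _ ⟨γ, f, S, ⟨hγ, hf⟩, heq, hS, .inl rfl⟩
      obtain ⟨ξm, hm⟩ := ih _ ⟨γ, f, S, ⟨hγ, hf⟩, heq, hS, .inr rfl⟩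
      exact ⟨_, .split V γ f S ξp ξm ⟨hγ, hf⟩ heq hS hp hm⟩

theorem isProx_of_algorithmReturns (hc : IsGroupNetwork grp η lam c) (ha : ∀ g, 0 ≤ lam * η g)
    {w : Fin p → ℝ} (h : AlgorithmReturns η lam c u w) : IsProx grp η lam u w := by
  obtain ⟨ξ, hξ, rfl⟩ := h
  have htight := hc.isLevelTight_of_computeFlow ha (fun j => abs_nonneg (u j))
    hc.infinitelyConnected_univ hξ
  have hvars : varsOf (Finset.univ : Finset (Vertex p κ)) = Finset.univ := by simp [varsOf]
  have hgrps : grpsOf (Finset.univ : Finset (Vertex p κ)) = Finset.univ := by simp [grpsOf]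
  rw [hvars, hgrps] at htight
  exact htight.isProx

end IsGroupNetwork

end Algorithm

theorem mainTheorem1_general {p : ℕ} {κ : Type*} [Fintype κ] [DecidableEq κ]
    {grp : κ → Finset (Fin p)} {η : κ → ℝ} {lam : ℝ} (ha : ∀ g, 0 ≤ lam * η g)
    (u : Fin p → ℝ) {c : Node p κ → Node p κ → ℝ≥0∞} (hc : IsGroupNetwork grp η lam c) :
    Acc (RecursiveCall η lam c (fun j => |u j|)) Finset.univ ∧
    (∃ w, AlgorithmReturns η lam c u w) ∧
    ∀ w, AlgorithmReturns η lam c u w → IsProx grp η lam u w := by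
  have hu : ∀ j, 0 ≤ |u j| := fun j => abs_nonneg _
  obtain ⟨ξ, hξ⟩ := hc.exists_computeFlow ha hu Finset.univ
  exact ⟨hc.acc_recursiveCall ha hu _, ⟨_, ξ, hξ, rfl⟩,
    fun _ => hc.isProx_of_algorithmReturns ha⟩

theorem mainTheorem1 {p : ℕ} {κ : Type*} [Fintype κ] [DecidableEq κ]
    (grp : κ → Finset (Fin p)) (η : κ → ℝ) (hη : ∀ g, 0 < η g) (lam : ℝ) (hlam : 0 ≤ lam)
    (u : Fin p → ℝ) (c : Node p κ → Node p κ → ℝ≥0∞)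
    (hc : c = canonicalGraph grp η lam ∨ IsEquivalentGraph grp η lam c) :
    Acc (RecursiveCall η lam c (fun j => |u j|)) Finset.univ ∧
    (∃ w, AlgorithmReturns η lam c u w) ∧
    ∀ w, AlgorithmReturns η lam c u w → IsProx grp η lam u w :=
  mainTheorem1_general (fun g => mul_nonneg hlam (hη g).le) u
    (hc.elim (fun h => h ▸ isGroupNetwork_canonicalGraph grp η lam) fun h => h.isGroupNetwork)
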